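/- **Conventions.** Let $M=[m]$ and let $N$ be a finite set of participants, written as a disjoint union $N=N_1\cup\dots\cup N_m$ (parts may be empty). A polymatroid is a finite set together with a real function on its subsets that vanishes at $\emptyset$, is monotone and is submodular; it is *integer* if all its values are integers. It is *linearly representable* if there are subspaces $E_i$ of a finite-dimensional vector space over a finite field such that the rank of each set $J$ is $\dim\sum_{i\in J}E_i$. We write $iJ$ for $\{i\}\cup J$. An *access structure* on $N$ is a nonempty family $\Gamma$ of subsets of $N$, closed under supersets, with $\emptyset\notin\Gamma$. It is *$m$-partite* (for the given partition) if $I\in\Gamma$ depends only on the numbers $|I\cap N_1|,\dots,|I\cap N_m|$. A *perfect scheme* is a polymatroid $(0\cup N,h)$ with $h(0)>0$ such that $h(0I)\in\{h(I),\,h(0)+h(I)\}$ for all $I\subseteq N$; it *realizes* $\Gamma$ if $h(0I)=h(I)\iff I\in\Gamma$, and it is *ideal* if $\max_{i\in N}h(i)/h(0)=1$. $\Gamma$ is *$\kappa$-ideal* if it is realized by an ideal perfect scheme. In an integer polymatroid $(M,f')$ the closure of $J$ is $\mathrm{cl}(J)=\{k\in M: f'(kJ)=f'(J)\}$, and a flat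 is a set $F$ with $\mathrm{cl}(F)=F$. A *modular cut* is a family $\mathcal M$ of flats such that every flat containing a member of $\mathcal M$ is in $\mathcal M$, and $F\cap G\in\mathcal M$ whenever $F,G\in\mathcal M$ and $f'(F)+f'(G)=f'(F\cup G)+f'(F\cap G)$. The *generic extension* of an integer polymatroid $f$ along an element $k$ by a new element $u$ is the extension with $f(uJ)=f(J)$ if $f(kJ)=f(J)$, and $f(uJ)=f(J)+1$ otherwise, for every set $J$ not containing $u$. **The procedure.** 1. Take an integer polymatroid $(M,f')$ with $f'(k)\le|N_k|$ for every $k\in M$. 2. Take a modular cut $\mathcal M$ in $(M,f')$ with $\mathrm{cl}(\emptyset)\notin\mathcal M$, and let $(0\cup M,f)$ be the extension of $f'$ given, for $J\subseteq M$, by $f(0J)=f'(J)$ if $\mathrm{cl}(J)\in\mathcal M$, and $f(0J)=f'(J)+1$ otherwise; thus $f(0)=1$. 3. For each $k\in M$ add $|N_k|$ generic elements along $k$, identified with the elements of $N_k$ (in any order of all elements of $N$), and then discard the elements of $M$. Let $(0\cup N,h)$ be the result and $\Gamma=\{I\subseteq N: h(I)=h(0I)\}$. **Theorem.** A family $\Gamma$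 of subsets of $N$ is a $\kappa$-ideal $m$-partite access structure on $N=N_1\cup\dots\cup N_m$ if and only if it is produced by this procedure from some $(M,f')$ and some nonempty modular cut $\mathcal M$. Moreover, in every run of the procedure: - $(0\cup M,f)$ is an integer polymatroid; - $h$ does not depend on the order of the extensions, and $(0\cup N,h)$ is a matroid; - if $\mathcal M\neq\emptyset$, then $(0\cup N,h)$ is an ideal perfect scheme; - if $(0\cup M,f)$ is linearly representable, then so is $(0\cup N,h)$; hence, if also $\mathcal M\ne\emptyset$, $\Gamma$ is realized by a linearly representable ideal perfect scheme. -/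

import Mathlib

/-- A polymatroid rank function on the finite ground set `E`. -/
structure IsPolymatroid {E : Type*} [DecidableEq E] (f : Finset E → ℝ) : Prop where
  rank_empty : f ∅ = 0
  mono : ∀ I J : Finset E, I ⊆ J → f I ≤ f J
  submodular : ∀ I J : Finset E, f (I ∪ J) + f (I ∩ J) ≤ f I + f J

/-- An integer polymatroid: a polymatroid all of whose ranks are integers. -/
def IsIntegerPolymatroid {E : Type*} [DecidableEq E] (f : Finset E → ℕ) : Prop :=
  IsPolymatroid fun J => (f J : ℝ)

/-- `h` is the rank function of a matroid on the ground set `E`. -/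
def IsMatroidRank {E : Type*} (h : Finset E → ℕ) : Prop :=
  ∃ μ : Matroid E, μ.E = Set.univ ∧ ∀ J : Finset E, μ.eRk (J : Set E) = (h J : ℕ∞)

/-- `f` is the dimension function of a family of subspaces of a finite-dimensional vector space
over a finite field. (Up to isomorphism all of these live in `Type`.) -/
def IsLinearlyRepresentable {E : Type*} (f : Finset E → ℝ) : Prop :=
  ∃ (F : Type) (_ : Field F) (_ : Finite F)
    (V : Type) (_ : AddCommGroup V) (_ : Module F V) (_ : FiniteDimensional F V)
    (W : E → Submodule F V),
    ∀ J : Finset E, f J = (Module.finrank F (⨆ i ∈ J, W i : Submodule F V) : ℝ)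

/-! ### Access structures and secret sharing schemes

The participants form the finite type `N`; the secret is `none : Option N`. -/

/-- An access structure: a nonempty family of subsets, closed under supersets, which does not
contain the empty set. -/
structure IsAccessStructure {N : Type*} (Γ : Set (Finset N)) : Prop where
  nonempty : Γ.Nonempty
  superset : ∀ I J : Finset N, I ∈ Γ → I ⊆ J → J ∈ Γ
  empty_notMem : ∅ ∉ Γ

/-- `Γ` is multipartite for the partition of `N` into the fibres of `part`: membership in `Γ`
depends only on the number of elements in each part. -/
def IsMultipartite {m : ℕ} {N : Type*} (part : N → Fin m) (Γ : Set (Finset N)) : Prop :=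
  ∀ I J : Finset N,
    (∀ k : Fin m, (I.filter fun i => part i = k).card = (J.filter fun i => part i = k).card) →
    (I ∈ Γ ↔ J ∈ Γ)

/-- A set of participants, as a subset of `0 ∪ N`. -/
def withoutSecret {N : Type*} (I : Finset N) : Finset (Option N) :=
  I.map Function.Embedding.some

/-- `0 ∪ I` for a set `I` of participants. -/
def withSecret {N : Type*} (I : Finset N) : Finset (Option N) :=
  I.insertNone

/-- A perfect secret sharing scheme in the polymatroidal framework. -/
structure IsPerfectScheme {N : Type*} [DecidableEq N] (h : Finset (Option N) → ℝ) : Prop where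
  polymatroid : IsPolymatroid h
  secret_pos : 0 < h {none}
  perfect : ∀ I : Finset N,
    h (withSecret I) = h {none} + h (withoutSecret I) ∨ h (withSecret I) = h (withoutSecret I)

/-- The scheme `h` realizes `Γ`. -/
def Realizes {N : Type*} (h : Finset (Option N) → ℝ) (Γ : Set (Finset N)) : Prop :=
  ∀ I : Finset N, h (withSecret I) = h (withoutSecret I) ↔ I ∈ Γ

/-- The complexity (information ratio): the largest share size relative to the secret size. -/
noncomputable def informationRatio {N : Type*} (h : Finset (Option N) → ℝ) : ℝ :=
  ⨆ i : N, h {some i} / h {none}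

/-- A (perfect) scheme is ideal if its complexity is `1`. -/
def IsIdealScheme {N : Type*} [DecidableEq N] (h : Finset (Option N) → ℝ) : Prop :=
  IsPerfectScheme h ∧ informationRatio h = 1

/-- `Γ` is `κ`-ideal: it is realized by an ideal polymatroid. -/
def IsKappaIdeal {N : Type*} [DecidableEq N] (Γ : Set (Finset N)) : Prop :=
  ∃ h : Finset (Option N) → ℝ, IsIdealScheme h ∧ Realizes h Γ

/-- `Γ` is realized by an ideal linear scheme. -/
def HasIdealLinearScheme {N : Type*} [DecidableEq N] (Γ : Set (Finset N)) : Prop :=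
  ∃ h : Finset (Option N) → ℝ, IsIdealScheme h ∧ Realizes h Γ ∧ IsLinearlyRepresentable h

/-! ### Modular cuts and the extension by the secret -/

/-- The closure of `J`: all elements which do not increase the rank of `J`. -/
def polyClosure {E : Type*} [Fintype E] [DecidableEq E] (f : Finset E → ℕ) (J : Finset E) :
    Finset E :=
  Finset.univ.filter fun k => f (insert k J) = f J

/-- A flat is a set that equals its closure. -/
def IsPolyFlat {E : Type*} [Fintype E] [DecidableEq E] (f : Finset E → ℕ) (J : Finset E) : Prop :=
  polyClosure f J = J

/-- A modular cut: a family of flats, closed upwards among the flats and closed under the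
intersection of modular pairs. -/
structure IsModularCut {E : Type*} [Fintype E] [DecidableEq E] (f : Finset E → ℕ)
    (C : Set (Finset E)) : Prop where
  flat : ∀ F ∈ C, IsPolyFlat f F
  superset : ∀ F G : Finset E, F ∈ C → IsPolyFlat f G → F ⊆ G → G ∈ C
  inter : ∀ F G : Finset E, F ∈ C → G ∈ C → f F + f G = f (F ∪ G) + f (F ∩ G) → F ∩ G ∈ C

open scoped Classical in
/-- The one-element extension of `f` by the secret `none`, given by the family `C` of flats. -/
noncomputable def secretExtension {E : Type*} [Fintype E] [DecidableEq E] (f : Finset E → ℕ)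
    (C : Set (Finset E)) (A : Finset (Option E)) : ℕ :=
  if none ∈ A ∧ polyClosure f A.eraseNone ∉ C then f A.eraseNone + 1 else f A.eraseNone

/-! ### Generic extensions -/

/-- The generic extension of `f` along `k` by a new element `u`. It agrees with `f` on the sets
that do not contain `u`; for a set `J` without `u`, the rank of `uJ` is `f J` if `f (kJ) = f J`,
and `f J + 1` otherwise. -/
def genericExtension {E : Type*} [DecidableEq E] (f : Finset E → ℕ) (u k : E)
    (A : Finset E) : ℕ :=
  if u ∈ A ∧ f (insert k (A.erase u)) ≠ f (A.erase u) then f (A.erase u) + 1 else f (A.erase u)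

/-- Starting from `f` on `0 ∪ M`, where `M = Fin m`, add the participants of the list one after
the other (the last entry first), the participant `i` generically along `part i`. The ground set
`0 ∪ M` is the left summand, participants are in the right summand; participants which have not
been added yet are disregarded. -/
def addGenericElements {m : ℕ} {N : Type*} [DecidableEq N] (part : N → Fin m)
    (f : Finset (Option (Fin m)) → ℕ) : List N → Finset (Option (Fin m) ⊕ N) → ℕ
  | [] => fun A => f A.toLeft
  | i :: l => genericExtension (addGenericElements part f l) (Sum.inr i) (Sum.inl (some (part i)))

/-- `0 ∪ N` as a subset of `0 ∪ M ∪ N`. -/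
def secretOrParticipant {m : ℕ} {N : Type*} : Option N → Option (Fin m) ⊕ N
  | none => Sum.inl none
  | some i => Sum.inr i

/-- The rank function on `0 ∪ N` which is obtained by adding the participants in the order `l`
and then discarding `M`. -/
def participantRank {m : ℕ} {N : Type*} [DecidableEq N] (part : N → Fin m)
    (f : Finset (Option (Fin m)) → ℕ) (l : List N) (J : Finset (Option N)) : ℕ :=
  addGenericElements part f l (J.image secretOrParticipant)

/-- `l` lists every participant exactly once. -/
def IsEnumeration {N : Type*} (l : List N) : Prop :=
  l.Nodup ∧ ∀ i : N, i ∈ l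

/-- The qualified sets of `h`: all `I ⊆ N` with `h(I) = h(0I)`. -/
def qualifiedSets {N : Type*} (h : Finset (Option N) → ℕ) : Set (Finset N) :=
  {I | h (withoutSecret I) = h (withSecret I)}

/-- Admissible data for the procedure: an integer polymatroid `f` on `M = Fin m` with
`f(k) ≤ |N_k|`, and a modular cut `C` such that the secret gets rank `1` in the extension. -/
structure IsProcedureInput {m : ℕ} {N : Type*} [Fintype N] (part : N → Fin m)
    (f : Finset (Fin m) → ℕ) (C : Set (Finset (Fin m))) : Prop where
  polymatroid : IsIntegerPolymatroid f
  rank_le : ∀ k : Fin m, f {k} ≤ (Finset.univ.filter fun i : N => part i = k).card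
  modularCut : IsModularCut f C
  secret_rank : secretExtension f C {none} = 1

/-!
Let `f` be the polymatroid on `0 ∪ M` and write `N_J` for the union of the parts `N_k`, `k ∈ J`.
Adding an element generically along `k` replaces the rank of a set `A` by
`min (f (kA)) (f A + 1)`, so that after all extensions the rank of a set of participants `I`,
with or without the secret, is
`min_J (f (J) + |I \ N_J|)` or `min_J (f (0J) + |I \ N_J|)`, where `J ⊆ M`
(`addGenericElements_isLeast`). All properties of a run of the procedure follow from this
formula: it does not mention the order of the extensions, it depends only on the numbers
`|I ∩ N_k|`, and the expression which is minimized is submodular in the pair `(I, J)`. The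
hypothesis `f (k) ≤ |N_k|` makes `J = M` a minimizer for `I = N`, so that `N` is qualified if the
modular cut is nonempty. A generic extension of a linear polymatroid is represented over a
larger field by a vector whose coordinates over the original field span the subspace of `k`
(`isLinearlyRepresentable_genericExtension`).

Conversely, let `Γ` be multipartite and realized by an ideal scheme. After removing the
participants which are irrelevant for `Γ` and averaging over the permutations which preserve the
parts, the scheme is symmetric in the members of each part
(`exists_symmetric_isPortPolymatroid`). A Brickell–Davenport argument shows that it is a matroid
`g` (`IsPortPolymatroid.exists_nat`). By symmetry, if `J` is the set of the parts contained in the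
closure of `I`, then the elements of `I \ N_J` can be removed one by one, each lowering the rank
by `1` and preserving membership in `Γ`; thus `g (I) = g (N_J) + |I \ N_J|`, and `N_J ∈ Γ` if
`I ∈ Γ` (`IsPortPolymatroid.exists_rank_eq`). Comparison with the formula above shows that the
procedure applied to `J ↦ g (N_J)` and the flats `F` with `N_F ∈ Γ` gives `Γ`.
-/

/-! ### Polymatroids -/

namespace IsPolymatroid

variable {E : Type*} [DecidableEq E] {f : Finset E → ℝ}

lemma nonneg (hf : IsPolymatroid f) (I : Finset E) : 0 ≤ f I := by
  simpa [hf.rank_empty] using hf.mono ∅ I (Finset.empty_subset I)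

lemma union_le (hf : IsPolymatroid f) (I J : Finset E) : f (I ∪ J) ≤ f I + f J := by
  linarith [hf.submodular I J, hf.nonneg (I ∩ J)]

/-- The increase of the rank caused by `K` is antitone in the set to which `K` is added. -/
lemma marginal (hf : IsPolymatroid f) {I J : Finset E} (hIJ : I ⊆ J) (K : Finset E) :
    f (J ∪ K) + f I ≤ f (I ∪ K) + f J := by
  have h := hf.submodular (I ∪ K) J
  have h1 : I ∪ K ∪ J = J ∪ K := by
    ext x; simp only [Finset.mem_union]; have := @hIJ x; tauto
  have h2 : f I ≤ f ((I ∪ K) ∩ J) :=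
    hf.mono _ _ (Finset.subset_inter Finset.subset_union_left hIJ)
  rw [h1] at h
  linarith

lemma marginal_insert (hf : IsPolymatroid f) {I J : Finset E} (hIJ : I ⊆ J) (e : E) :
    f (insert e J) + f I ≤ f (insert e I) + f J := by
  have h := hf.marginal hIJ {e}
  rwa [Finset.union_comm J, Finset.union_comm I, ← Finset.insert_eq, ← Finset.insert_eq] at h

lemma insert_le (hf : IsPolymatroid f) (e : E) (I : Finset E) :
    f (insert e I) ≤ f I + f {e} := by
  have := hf.union_le {e} I
  rw [← Finset.insert_eq] at this
  linarith

/-- Elements which individually do not increase the rank of `I` do not increase it jointly. -/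
lemma union_eq_of_forall_insert (hf : IsPolymatroid f) {I J : Finset E}
    (h : ∀ e ∈ J, f (insert e I) = f I) : f (I ∪ J) = f I := by
  induction J using Finset.induction_on with
  | empty => simp
  | insert e J _ ih =>
    have h1 := ih fun x hx => h x (Finset.mem_insert_of_mem hx)
    have h2 := hf.marginal_insert (Finset.subset_union_left : I ⊆ I ∪ J) e
    have h3 := h e (Finset.mem_insert_self e J)
    have h4 := hf.mono _ _ (Finset.subset_insert e (I ∪ J))
    rw [Finset.union_insert]
    linarith

lemma union_le_add_card (hf : IsPolymatroid f) (h1 : ∀ e, f {e} ≤ 1) (I K : Finset E) :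
    f (I ∪ K) ≤ f I + K.card := by
  induction K using Finset.induction_on with
  | empty => simp
  | insert e K he ih =>
    rw [Finset.union_insert, Finset.card_insert_of_notMem he]
    push_cast
    linarith [hf.insert_le e (I ∪ K), h1 e]

lemma le_card (hf : IsPolymatroid f) (h1 : ∀ e, f {e} ≤ 1) (I : Finset E) : f I ≤ I.card := by
  simpa [hf.rank_empty] using hf.union_le_add_card h1 ∅ I

lemma eq_card_of_subset (hf : IsPolymatroid f) (h1 : ∀ e, f {e} ≤ 1) {I J : Finset E}
    (hJ : f J = J.card) (hIJ : I ⊆ J) : f I = I.card := by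
  refine le_antisymm (hf.le_card h1 I) ?_
  have h := hf.union_le_add_card h1 I (J \ I)
  rw [Finset.union_sdiff_of_subset hIJ, hJ, ← Finset.card_sdiff_add_card_eq_card hIJ] at h
  push_cast at h
  linarith

/-- If every minimal set `C` with `f C < |C|` has an element which can be removed without
lowering the rank, then the ranks are integers. -/
lemma exists_nat_of_circuits (hf : IsPolymatroid f) (h1 : ∀ e, f {e} ≤ 1)
    (hC : ∀ C : Finset E, f C < C.card → (∀ D, D ⊂ C → f D = D.card) →
      ∃ y ∈ C, f (C.erase y) = f C) (X : Finset E) : ∃ n : ℕ, f X = n := by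
  classical
  obtain ⟨B, hB, hmax⟩ := Finset.exists_max_image (X.powerset.filter fun B => f B = B.card)
    Finset.card ⟨∅, by simp [hf.rank_empty]⟩
  simp only [Finset.mem_filter, Finset.mem_powerset] at hB hmax
  refine ⟨B.card, ?_⟩
  have key : ∀ e ∈ X, f (insert e B) = f B := by
    intro e heX
    by_cases heB : e ∈ B
    · rw [Finset.insert_eq_of_mem heB]
    have hlt : f (insert e B) < (insert e B).card := by
      refine lt_of_le_of_ne (hf.le_card h1 _) fun h => ?_
      have := hmax (insert e B) ⟨Finset.insert_subset heX hB.1, h⟩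
      rw [Finset.card_insert_of_notMem heB] at this
      omega
    obtain ⟨C, hCm, hmin⟩ := Finset.exists_min_image
      ((insert e B).powerset.filter fun C => f C < C.card) Finset.card
      ⟨_, Finset.mem_filter.2 ⟨Finset.mem_powerset_self _, hlt⟩⟩
    simp only [Finset.mem_filter, Finset.mem_powerset] at hCm hmin
    have hsub : ∀ D, D ⊂ C → f D = D.card := fun D hD => by
      by_contra hne
      have := hmin D ⟨hD.subset.trans hCm.1, lt_of_le_of_ne (hf.le_card h1 _) hne⟩
      have := Finset.card_lt_card hD
      omega
    have heC : e ∈ C := by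
      by_contra he
      have := hf.eq_card_of_subset h1 hB.2 ((Finset.subset_insert_iff_of_notMem he).1 hCm.1)
      linarith [hCm.2]
    obtain ⟨y, hy, hyC⟩ := hC C hCm.2 hsub
    have h2 := hsub _ (Finset.erase_ssubset hy)
    have h3 := hsub _ (Finset.erase_ssubset heC)
    rw [Finset.card_erase_of_mem hy] at h2
    rw [Finset.card_erase_of_mem heC] at h3
    have h4 := hf.marginal_insert (Finset.subset_insert_iff.1 hCm.1) e
    rw [Finset.insert_erase heC] at h4
    have h5 := hf.mono _ _ (Finset.subset_insert e B)
    linarith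
  have := hf.union_eq_of_forall_insert key
  rw [Finset.union_eq_right.2 hB.1] at this
  rw [this, hB.2]

end IsPolymatroid

namespace IsIntegerPolymatroid

variable {E : Type*} [DecidableEq E] {f : Finset E → ℕ}

lemma rank_empty (hf : IsIntegerPolymatroid f) : f ∅ = 0 := by
  exact_mod_cast IsPolymatroid.rank_empty hf

lemma mono (hf : IsIntegerPolymatroid f) {I J : Finset E} (h : I ⊆ J) : f I ≤ f J := by
  exact_mod_cast IsPolymatroid.mono hf I J h

lemma submodular (hf : IsIntegerPolymatroid f) (I J : Finset E) :
    f (I ∪ J) + f (I ∩ J) ≤ f I + f J := by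
  exact_mod_cast IsPolymatroid.submodular hf I J

lemma union_eq_of_forall_insert (hf : IsIntegerPolymatroid f) {I J : Finset E}
    (h : ∀ e ∈ J, f (insert e I) = f I) : f (I ∪ J) = f I := by
  exact_mod_cast IsPolymatroid.union_eq_of_forall_insert hf (I := I) (J := J)
    fun e he => by exact_mod_cast h e he

lemma union_le_add_card (hf : IsIntegerPolymatroid f) (h1 : ∀ e, f {e} ≤ 1) (I K : Finset E) :
    f (I ∪ K) ≤ f I + K.card := by
  exact_mod_cast IsPolymatroid.union_le_add_card hf (fun e => by exact_mod_cast h1 e) I K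

lemma of_nat (h0 : f ∅ = 0) (hm : ∀ I J, I ⊆ J → f I ≤ f J)
    (hs : ∀ I J, f (I ∪ J) + f (I ∩ J) ≤ f I + f J) : IsIntegerPolymatroid f :=
  ⟨by exact_mod_cast h0, fun I J h => by exact_mod_cast hm I J h,
    fun I J => by exact_mod_cast hs I J⟩

/-- An integer polymatroid in which all elements have rank at most `1` is a matroid: the
independent sets are those whose rank is their cardinality. -/
theorem isMatroidRank [Finite E] (hf : IsIntegerPolymatroid f) (h1 : ∀ e, f {e} ≤ 1) :
    IsMatroidRank f := by
  have hle : ∀ I, f I ≤ I.card := fun I => by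
    simpa [hf.rank_empty] using hf.union_le_add_card h1 ∅ I
  let P : IndepMatroid E := IndepMatroid.ofFinset Set.univ (fun I => f I = I.card)
    (by simp [hf.rank_empty])
    (fun I J hJ hIJ => by
      exact_mod_cast IsPolymatroid.eq_card_of_subset hf (fun e => by exact_mod_cast h1 e)
        (I := I) (J := J) (by exact_mod_cast hJ) hIJ)
    (fun I J hI hJ hIJ => by
      by_contra! hne
      have h : f (I ∪ J) = f I := hf.union_eq_of_forall_insert fun e he => by
        by_cases heI : e ∈ I
        · rw [Finset.insert_eq_of_mem heI]
        have h2 := hne e he heI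
        have h3 := hle (insert e I)
        have h4 := hf.mono (Finset.subset_insert e I)
        rw [Finset.card_insert_of_notMem heI] at h2 h3
        omega
      have := hf.mono (Finset.subset_union_right : J ⊆ I ∪ J)
      omega)
    (fun _ _ => Set.subset_univ _)
  have hind : ∀ I : Finset E, P.matroid.Indep I ↔ f I = I.card := fun I => by
    rw [IndepMatroid.matroid_Indep]
    exact IndepMatroid.ofFinset_indep ..
  refine ⟨P.matroid, rfl, fun J => ?_⟩
  obtain ⟨B, hB⟩ := P.matroid.exists_isBasis' (J : Set E)
  obtain ⟨B, rfl⟩ := (J.finite_toSet.subset hB.subset).exists_finset_coe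
  rw [hB.eRk_eq_encard, Set.encard_coe_eq_coe_finsetCard]
  have hBi := (hind B).1 hB.indep
  have hBJ : B ⊆ J := by exact_mod_cast hB.subset
  have h : f (B ∪ J) = f B := hf.union_eq_of_forall_insert fun e he => by
    by_cases heB : e ∈ B
    · rw [Finset.insert_eq_of_mem heB]
    have h2 : ¬ P.matroid.Indep ((insert e B : Finset E) : Set E) := fun hi => by
      rw [Finset.coe_insert] at hi
      exact heB (by exact_mod_cast hB.mem_of_insert_indep (by exact_mod_cast he) hi)
    rw [hind, Finset.card_insert_of_notMem heB] at h2
    have h3 := hle (insert e B)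
    have h4 := hf.mono (Finset.subset_insert e B)
    rw [Finset.card_insert_of_notMem heB] at h3
    omega
  rw [Finset.union_eq_right.2 hBJ] at h
  rw [h, hBi]

end IsIntegerPolymatroid

/-! ### Modular cuts and the extension by the secret -/

namespace IsIntegerPolymatroid

variable {E : Type*} [Fintype E] [DecidableEq E] {f : Finset E → ℕ}

lemma mem_polyClosure {k : E} {J : Finset E} : k ∈ polyClosure f J ↔ f (insert k J) = f J := by
  simp [polyClosure]

lemma subset_polyClosure (J : Finset E) : J ⊆ polyClosure f J := fun k hk => by
  rw [mem_polyClosure, Finset.insert_eq_of_mem hk]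

lemma rank_polyClosure (hf : IsIntegerPolymatroid f) (J : Finset E) :
    f (polyClosure f J) = f J := by
  have := hf.union_eq_of_forall_insert (I := J) (J := polyClosure f J) fun e => mem_polyClosure.1
  rwa [Finset.union_eq_right.2 (subset_polyClosure J)] at this

lemma polyClosure_mono (hf : IsIntegerPolymatroid f) {J K : Finset E} (h : J ⊆ K) :
    polyClosure f J ⊆ polyClosure f K := fun k hk => by
  rw [mem_polyClosure] at hk ⊢
  have h1 : f (insert k K) + f J ≤ f (insert k J) + f K := by
    exact_mod_cast IsPolymatroid.marginal_insert hf h k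
  have h2 := hf.mono (Finset.subset_insert k K)
  omega

lemma polyClosure_eq_of_rank_eq (hf : IsIntegerPolymatroid f) {J K : Finset E} (h : J ⊆ K)
    (hr : f J = f K) : polyClosure f J = polyClosure f K := by
  refine (hf.polyClosure_mono h).antisymm fun k hk => ?_
  rw [mem_polyClosure] at hk ⊢
  have h1 := hf.mono (Finset.insert_subset_insert k h)
  have h2 := hf.mono (Finset.subset_insert k J)
  omega

lemma isPolyFlat_polyClosure (hf : IsIntegerPolymatroid f) (J : Finset E) :
    IsPolyFlat f (polyClosure f J) :=
  (hf.polyClosure_eq_of_rank_eq (subset_polyClosure J) (hf.rank_polyClosure J).symm).symm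

lemma polyClosure_mem_of_subset (hf : IsIntegerPolymatroid f) {C : Set (Finset E)}
    (hC : IsModularCut f C) {J K : Finset E} (h : J ⊆ K) (hJ : polyClosure f J ∈ C) :
    polyClosure f K ∈ C :=
  hC.superset _ _ hJ (hf.isPolyFlat_polyClosure K) (hf.polyClosure_mono h)

/-- A modular cut is closed under the intersection of modular pairs also when it is regarded as
the family of all sets whose closure is in the cut. -/
lemma polyClosure_inter_mem (hf : IsIntegerPolymatroid f) {C : Set (Finset E)}
    (hC : IsModularCut f C) {I J : Finset E} (hI : polyClosure f I ∈ C)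
    (hJ : polyClosure f J ∈ C) (hIJ : f I + f J = f (I ∪ J) + f (I ∩ J)) :
    polyClosure f (I ∩ J) ∈ C := by
  have hsub : I ∩ J ⊆ polyClosure f I ∩ polyClosure f J :=
    Finset.inter_subset_inter (subset_polyClosure I) (subset_polyClosure J)
  have h1 := hf.mono hsub
  have h2 : f (I ∪ J) ≤ f (polyClosure f I ∪ polyClosure f J) :=
    hf.mono (Finset.union_subset_union (subset_polyClosure I) (subset_polyClosure J))
  have h3 := hf.submodular (polyClosure f I) (polyClosure f J)
  have h4 := hf.rank_polyClosure I
  have h5 := hf.rank_polyClosure J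
  have hmem := hC.inter _ _ hI hJ (by omega)
  have hflat : polyClosure f (polyClosure f I ∩ polyClosure f J) =
      polyClosure f I ∩ polyClosure f J := hC.flat _ hmem
  rwa [hf.polyClosure_eq_of_rank_eq hsub (by omega), hflat]

theorem secretExtension (hf : IsIntegerPolymatroid f) {C : Set (Finset E)}
    (hC : IsModularCut f C) : IsIntegerPolymatroid (secretExtension f C) := by
  classical
  refine .of_nat (by simp [_root_.secretExtension, hf.rank_empty]) (fun I J hIJ => ?_)
    (fun I J => ?_)
  · have hsub : I.eraseNone ⊆ J.eraseNone := Finset.eraseNone.monotone hIJ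
    have h1 := hf.mono hsub
    have h2 : none ∈ I → none ∈ J := fun h => hIJ h
    have h3 : f I.eraseNone = f J.eraseNone →
        polyClosure f I.eraseNone = polyClosure f J.eraseNone := hf.polyClosure_eq_of_rank_eq hsub
    simp only [_root_.secretExtension]
    by_cases he : f I.eraseNone = f J.eraseNone
    · rw [h3 he]
      split_ifs <;> first | omega | (exfalso; tauto)
    · split_ifs <;> omega
  · have h1 := hf.submodular I.eraseNone J.eraseNone
    have h2 : polyClosure f I.eraseNone ∈ C → polyClosure f (I.eraseNone ∪ J.eraseNone) ∈ C :=
      hf.polyClosure_mem_of_subset hC Finset.subset_union_left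
    have h3 : polyClosure f J.eraseNone ∈ C → polyClosure f (I.eraseNone ∪ J.eraseNone) ∈ C :=
      hf.polyClosure_mem_of_subset hC Finset.subset_union_right
    have h4 : polyClosure f I.eraseNone ∈ C → polyClosure f J.eraseNone ∈ C →
        f I.eraseNone + f J.eraseNone =
          f (I.eraseNone ∪ J.eraseNone) + f (I.eraseNone ∩ J.eraseNone) →
        polyClosure f (I.eraseNone ∩ J.eraseNone) ∈ C := hf.polyClosure_inter_mem hC
    simp only [_root_.secretExtension, Finset.eraseNone_union, Finset.eraseNone_inter,
      Finset.mem_union, Finset.mem_inter]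
    generalize f I.eraseNone = a, f J.eraseNone = b, f (I.eraseNone ∪ J.eraseNone) = c,
      f (I.eraseNone ∩ J.eraseNone) = d, polyClosure f I.eraseNone = I',
      polyClosure f J.eraseNone = J', polyClosure f (I.eraseNone ∪ J.eraseNone) = U,
      polyClosure f (I.eraseNone ∩ J.eraseNone) = V at *
    by_cases hI : none ∈ I <;> by_cases hJ : none ∈ J <;>
      by_cases hI' : I' ∈ C <;> by_cases hJ' : J' ∈ C <;> grind

end IsIntegerPolymatroid

@[simp] lemma secretExtension_withoutSecret {E : Type*} [Fintype E] [DecidableEq E]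
    (f : Finset E → ℕ) (C : Set (Finset E)) (J : Finset E) :
    secretExtension f C (withoutSecret J) = f J := by
  simp [secretExtension, withoutSecret]

open scoped Classical in
lemma secretExtension_withSecret {E : Type*} [Fintype E] [DecidableEq E]
    (f : Finset E → ℕ) (C : Set (Finset E)) (J : Finset E) :
    secretExtension f C (withSecret J) = if polyClosure f J ∈ C then f J else f J + 1 := by
  simp only [secretExtension, withSecret, Finset.eraseNone_insertNone, Finset.mem_insertNone]
  split_ifs with h1 h2 h2 <;> simp_all

/-! ### The closed formula for generic extensions -/

lemma secretOrParticipant_injective {m : ℕ} {N : Type*} :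
    Function.Injective (secretOrParticipant (m := m) (N := N)) := by
  rintro (_ | i) (_ | j) h <;> simp_all [secretOrParticipant]

section GenericExtension

variable {m : ℕ} {N : Type*} [DecidableEq N] (part : N → Fin m)

/-- The rank of `A` after adding the participants of `l` generically is the minimum over
`J ⊆ M` of this number: the elements of `A` in parts outside `J` are counted one by one, the
remaining elements are replaced by `J`. -/
def genericCost (f : Finset (Option (Fin m)) → ℕ) (l : List N)
    (A : Finset (Option (Fin m) ⊕ N)) (J : Finset (Fin m)) : ℕ :=
  f (A.toLeft ∪ withoutSecret J) + (A.toRight.filter fun i => i ∈ l ∧ part i ∉ J).card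

variable {f : Finset (Option (Fin m)) → ℕ}

lemma genericCost_mono (hf : IsIntegerPolymatroid f) (l : List N)
    {A B : Finset (Option (Fin m) ⊕ N)} (h : A ⊆ B) (J : Finset (Fin m)) :
    genericCost part f l A J ≤ genericCost part f l B J :=
  add_le_add (hf.mono (Finset.union_subset_union_left (Finset.toLeft_subset_toLeft h)))
    (Finset.card_le_card (Finset.filter_subset_filter _ (Finset.toRight_subset_toRight h)))

lemma genericCost_submodular (hf : IsIntegerPolymatroid f) (l : List N)
    (A B : Finset (Option (Fin m) ⊕ N)) (I J : Finset (Fin m)) :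
    genericCost part f l (A ∪ B) (I ∪ J) + genericCost part f l (A ∩ B) (I ∩ J) ≤
      genericCost part f l A I + genericCost part f l B J := by
  unfold genericCost
  have h1 := hf.submodular (A.toLeft ∪ withoutSecret I) (B.toLeft ∪ withoutSecret J)
  have h2 : (A ∪ B).toLeft ∪ withoutSecret (I ∪ J) =
      (A.toLeft ∪ withoutSecret I) ∪ (B.toLeft ∪ withoutSecret J) := by
    simp only [withoutSecret, Finset.toLeft_union, Finset.map_union]
    exact Finset.union_union_union_comm _ _ _ _
  have h3 : f ((A ∩ B).toLeft ∪ withoutSecret (I ∩ J)) ≤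
      f ((A.toLeft ∪ withoutSecret I) ∩ (B.toLeft ∪ withoutSecret J)) := by
    refine hf.mono fun x => ?_
    simp only [withoutSecret, Finset.toLeft_inter, Finset.map_inter, Finset.mem_union,
      Finset.mem_inter]
    tauto
  have h4 := Finset.card_union_add_card_inter
    ((A ∪ B).toRight.filter fun i => i ∈ l ∧ part i ∉ I ∪ J)
    ((A ∩ B).toRight.filter fun i => i ∈ l ∧ part i ∉ I ∩ J)
  have h5 := Finset.card_union_add_card_inter
    (A.toRight.filter fun i => i ∈ l ∧ part i ∉ I) (B.toRight.filter fun i => i ∈ l ∧ part i ∉ J)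
  have h6 : ((A ∪ B).toRight.filter fun i => i ∈ l ∧ part i ∉ I ∪ J) ∪
      ((A ∩ B).toRight.filter fun i => i ∈ l ∧ part i ∉ I ∩ J) ⊆
      (A.toRight.filter fun i => i ∈ l ∧ part i ∉ I) ∪
        (B.toRight.filter fun i => i ∈ l ∧ part i ∉ J) := fun x => by
    simp only [Finset.mem_union, Finset.mem_inter, Finset.mem_filter, Finset.mem_toRight]
    tauto
  have h7 : ((A ∪ B).toRight.filter fun i => i ∈ l ∧ part i ∉ I ∪ J) ∩
      ((A ∩ B).toRight.filter fun i => i ∈ l ∧ part i ∉ I ∩ J) ⊆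
      (A.toRight.filter fun i => i ∈ l ∧ part i ∉ I) ∩
        (B.toRight.filter fun i => i ∈ l ∧ part i ∉ J) := fun x => by
    simp only [Finset.mem_union, Finset.mem_inter, Finset.mem_filter, Finset.mem_toRight]
    tauto
  have h8 := Finset.card_le_card h6
  have h9 := Finset.card_le_card h7
  rw [h2]
  omega

/-- A generic extension keeps the minimum formula: adding `u` along `k` replaces the rank of `uA`
by the minimum of the ranks of `kA` and `A`, the latter increased by `1`; these are the minima of
the cost over the sets `J` with `k ∈ J` and with `k ∉ J`. -/
theorem addGenericElements_isLeast (hf : IsIntegerPolymatroid f) {l : List N} (hl : l.Nodup)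
    (A : Finset (Option (Fin m) ⊕ N)) :
    IsLeast (Set.range (genericCost part f l A)) (addGenericElements part f l A) := by
  induction l generalizing A with
  | nil =>
    refine ⟨⟨∅, by simp [genericCost, addGenericElements, withoutSecret]⟩, ?_⟩
    rintro _ ⟨J, rfl⟩
    simpa [genericCost, addGenericElements] using hf.mono Finset.subset_union_left
  | cons i l ih =>
    have hil := (List.nodup_cons.1 hl).1
    replace ih := ih (List.nodup_cons.1 hl).2
    set g := addGenericElements part f l with hg
    have hlow : ∀ B J, g B ≤ genericCost part f l B J := fun B J => (ih B).2 ⟨J, rfl⟩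
    simp only [addGenericElements, genericExtension, ← hg]
    by_cases hi : Sum.inr i ∈ A
    · set B := A.erase (Sum.inr i) with hB
      have hleft : A.toLeft = B.toLeft := by ext x; simp [hB]
      have hcost : ∀ J, genericCost part f (i :: l) A J =
          genericCost part f l B J + if part i ∈ J then 0 else 1 := fun J => by
        unfold genericCost
        rw [hleft, add_assoc]
        congr 1
        split_ifs with h
        · rw [add_zero]
          congr 1
          ext x
          simp only [hB, Finset.mem_filter, Finset.mem_toRight, List.mem_cons, Finset.mem_erase,
            ne_eq, Sum.inr.injEq]
          grind
        · rw [← Finset.card_insert_of_notMem (a := i) (by simp [hil])]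
          congr 1
          ext x
          simp only [hB, Finset.mem_filter, Finset.mem_toRight, List.mem_cons, Finset.mem_erase,
            ne_eq, Sum.inr.injEq, Finset.mem_insert]
          grind
      have hk1 : ∀ J, part i ∈ J → genericCost part f l (insert (Sum.inl (some (part i))) B) J =
          genericCost part f l B J := fun J hJ => by
        unfold genericCost
        congr 2
        · ext x
          simp only [withoutSecret, Finset.mem_union, Finset.mem_toLeft, Finset.mem_insert,
            Sum.inl.injEq, Finset.mem_map, Function.Embedding.some_apply]
          grind
        · ext x; simp
      have hk2 : ∀ J, genericCost part f l B (insert (part i) J) ≤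
          genericCost part f l (insert (Sum.inl (some (part i))) B) J := fun J => by
        unfold genericCost
        refine add_le_add (hf.mono fun x => ?_) (Finset.card_le_card fun x => ?_)
        · simp only [withoutSecret, Finset.mem_union, Finset.mem_toLeft, Finset.mem_insert,
            Sum.inl.injEq, Finset.mem_map, Function.Embedding.some_apply]
          grind
        · simp only [Finset.mem_filter, Finset.mem_toRight, Finset.mem_insert]
          grind
      obtain ⟨J₁, hJ₁⟩ := (ih B).1
      obtain ⟨J₂, hJ₂⟩ := (ih (insert (Sum.inl (some (part i))) B)).1
      have hmono : g B ≤ g (insert (Sum.inl (some (part i))) B) := by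
        rw [← hJ₂]
        exact (hlow B J₂).trans (genericCost_mono part hf l (Finset.subset_insert _ _) J₂)
      have hlower : ∀ J, (if Sum.inr i ∈ A ∧ g (insert (Sum.inl (some (part i))) B) ≠ g B
          then g B + 1 else g B) ≤ genericCost part f (i :: l) A J := fun J => by
        rw [hcost]
        have h1 := hlow B J
        have h2 := hlow (insert (Sum.inl (some (part i))) B) J
        have h3 := hk1 J
        split_ifs with h4 h5 h5
        · rw [h3 h5] at h2
          omega
        · omega
        · omega
        · omega
      refine ⟨?_, by rintro _ ⟨J, rfl⟩; exact hlower J⟩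
      by_cases hne : g (insert (Sum.inl (some (part i))) B) = g B
      · refine ⟨insert (part i) J₂, le_antisymm ?_ (hlower _)⟩
        rw [hcost, if_pos (Finset.mem_insert_self _ _), if_neg fun h => h.2 hne, add_zero, ← hne,
          ← hJ₂]
        exact hk2 J₂
      · refine ⟨J₁, le_antisymm ?_ (hlower _)⟩
        rw [hcost, hJ₁, if_pos (c := Sum.inr i ∈ A ∧ _) ⟨hi, hne⟩]
        split_ifs <;> omega
    · have hcost : genericCost part f (i :: l) A = genericCost part f l A := by
        ext J
        unfold genericCost
        congr 2
        ext x
        simp only [Finset.mem_filter, Finset.mem_toRight, List.mem_cons]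
        grind
      rw [if_neg (by simp [hi]), Finset.erase_eq_of_notMem hi, hcost]
      exact ih A

theorem isIntegerPolymatroid_addGenericElements (hf : IsIntegerPolymatroid f) {l : List N}
    (hl : l.Nodup) : IsIntegerPolymatroid (addGenericElements part f l) := by
  have hleast := addGenericElements_isLeast part hf hl
  refine .of_nat ?_ (fun A B hAB => ?_) (fun A B => ?_)
  · refine Nat.le_zero.1 ((hleast ∅).2 ⟨∅, ?_⟩)
    have h : (∅ : Finset (Option (Fin m) ⊕ N)).toLeft = ∅ := rfl
    simp [genericCost, withoutSecret, h, hf.rank_empty]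
  · obtain ⟨J, hJ⟩ := (hleast B).1
    rw [← hJ]
    exact ((hleast A).2 ⟨J, rfl⟩).trans (genericCost_mono part hf l hAB J)
  · obtain ⟨I, hI⟩ := (hleast A).1
    obtain ⟨J, hJ⟩ := (hleast B).1
    rw [← hI, ← hJ]
    exact (add_le_add ((hleast _).2 ⟨_, rfl⟩) ((hleast _).2 ⟨_, rfl⟩)).trans
      (genericCost_submodular part hf l A B I J)

theorem isIntegerPolymatroid_participantRank (hf : IsIntegerPolymatroid f) {l : List N}
    (hl : l.Nodup) : IsIntegerPolymatroid (participantRank part f l) := by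
  have h := isIntegerPolymatroid_addGenericElements part hf hl
  refine .of_nat (by simpa [participantRank] using h.rank_empty)
    (fun A B hAB => h.mono (Finset.image_subset_image hAB)) (fun A B => ?_)
  simp only [participantRank]
  rw [Finset.image_union, Finset.image_inter _ _ secretOrParticipant_injective]
  exact h.submodular _ _

theorem participantRank_withoutSecret_isLeast (hf : IsIntegerPolymatroid f) {l : List N}
    (hl : IsEnumeration l) (I : Finset N) :
    IsLeast (Set.range fun J : Finset (Fin m) =>
        f (withoutSecret J) + (I.filter fun i => part i ∉ J).card)
      (participantRank part f l (withoutSecret I)) := by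
  have h := addGenericElements_isLeast part hf hl.1 ((withoutSecret I).image secretOrParticipant)
  have hc : genericCost part f l ((withoutSecret I).image secretOrParticipant) = fun J =>
      f (withoutSecret J) + (I.filter fun i => part i ∉ J).card := by
    ext J
    unfold genericCost
    congr 2
    · ext x
      simp [withoutSecret, secretOrParticipant]
    · ext x
      simp [withoutSecret, secretOrParticipant, hl.2]
  rwa [hc] at h

theorem participantRank_withSecret_isLeast (hf : IsIntegerPolymatroid f) {l : List N}
    (hl : IsEnumeration l) (I : Finset N) :
    IsLeast (Set.range fun J : Finset (Fin m) =>
        f (withSecret J) + (I.filter fun i => part i ∉ J).card)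
      (participantRank part f l (withSecret I)) := by
  have h := addGenericElements_isLeast part hf hl.1 ((withSecret I).image secretOrParticipant)
  have hc : genericCost part f l ((withSecret I).image secretOrParticipant) = fun J =>
      f (withSecret J) + (I.filter fun i => part i ∉ J).card := by
    ext J
    unfold genericCost
    congr 2
    · ext (_ | x) <;>
        simp [withSecret, withoutSecret, secretOrParticipant, Option.exists]
    · ext x
      simp [withSecret, secretOrParticipant, Option.exists, hl.2]
  rwa [hc] at h

end GenericExtension

lemma exists_eq_withoutSecret_or_withSecret {N : Type*} [DecidableEq N] (S : Finset (Option N)) :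
    ∃ I : Finset N, S = withoutSecret I ∨ S = withSecret I := by
  refine ⟨S.eraseNone, ?_⟩
  by_cases h : none ∈ S
  · right
    simp [withSecret, Finset.insert_eq_of_mem h]
  · left
    simp [withoutSecret, Finset.erase_eq_of_notMem h]

/-! ### The rank function produced by the procedure -/

lemma withoutSecret_subset_withSecret {N : Type*} (I : Finset N) :
    withoutSecret I ⊆ withSecret I := by
  intro x
  cases x <;> simp [withSecret, withoutSecret]

lemma card_filter_notMem_eq {m : ℕ} {N : Type*} {part : N → Fin m} {I I' : Finset N}
    (h : ∀ k, (I.filter fun i => part i = k).card = (I'.filter fun i => part i = k).card)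
    (J : Finset (Fin m)) :
    (I.filter fun i => part i ∉ J).card = (I'.filter fun i => part i ∉ J).card := by
  have key : ∀ I : Finset N, (I.filter fun i => part i ∉ J).card =
      ∑ k ∈ Jᶜ, (I.filter fun i => part i = k).card := fun I => by
    rw [Finset.card_eq_sum_card_fiberwise (f := part) (t := Jᶜ)
      (fun i hi => by simpa using (Finset.mem_filter.1 hi).2)]
    refine Finset.sum_congr rfl fun k hk => ?_
    rw [Finset.filter_filter]
    congr 1
    ext i
    simp only [Finset.mem_filter, Finset.mem_compl] at hk ⊢
    grind
  rw [key, key]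
  exact Finset.sum_congr rfl fun k _ => h k

lemma realizes_qualifiedSets {N : Type*} (h : Finset (Option N) → ℕ) :
    Realizes (fun J => (h J : ℝ)) (qualifiedSets h) := fun I => by
  simp only [qualifiedSets, Set.mem_ofPred_eq, Nat.cast_inj]
  exact eq_comm

namespace IsProcedureInput

variable {m : ℕ} {N : Type*} [Fintype N] {part : N → Fin m}
  {f : Finset (Fin m) → ℕ} {C : Set (Finset (Fin m))}

lemma rank_union_le (hin : IsProcedureInput part f C) (J K : Finset (Fin m)) :
    f (J ∪ K) ≤ f J + (Finset.univ.filter fun i : N => part i ∈ K).card := by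
  classical
  induction K using Finset.induction_on with
  | empty => simp
  | insert k K hk ih =>
    have h1 : f (insert k (J ∪ K)) ≤ f (J ∪ K) + f {k} := by
      exact_mod_cast IsPolymatroid.insert_le hin.polymatroid k (J ∪ K)
    have h2 := hin.rank_le k
    have h3 : (Finset.univ.filter fun i : N => part i ∈ insert k K) =
        (Finset.univ.filter fun i : N => part i = k) ∪
          (Finset.univ.filter fun i : N => part i ∈ K) := by
      ext i; simp
    rw [Finset.union_insert, h3, Finset.card_union_of_disjoint]
    · omega
    · rw [Finset.disjoint_filter]
      rintro i - rfl
      exact hk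

lemma isIntegerPolymatroid_secretExtension (hin : IsProcedureInput part f C) :
    IsIntegerPolymatroid (secretExtension f C) :=
  hin.polymatroid.secretExtension hin.modularCut

variable [DecidableEq N] {l : List N}

lemma isIntegerPolymatroid_participantRank (hin : IsProcedureInput part f C)
    (hl : IsEnumeration l) :
    IsIntegerPolymatroid (participantRank part (secretExtension f C) l) :=
  _root_.isIntegerPolymatroid_participantRank part hin.isIntegerPolymatroid_secretExtension hl.1

lemma participantRank_secret (hin : IsProcedureInput part f C) (hl : IsEnumeration l) :
    participantRank part (secretExtension f C) l {none} = 1 := by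
  have hf := hin.isIntegerPolymatroid_secretExtension
  have h := participantRank_withSecret_isLeast part hf hl ∅
  obtain ⟨J, hJ⟩ := h.1
  have h1 := h.2 ⟨∅, rfl⟩
  have h2 := hf.mono (Finset.insertNone.monotone (Finset.empty_subset J))
  have h3 := hin.secret_rank
  change secretExtension f C {none} ≤ secretExtension f C (withSecret J) at h2
  change participantRank part (secretExtension f C) l {none} ≤
    secretExtension f C {none} + _ at h1
  change _ = participantRank part (secretExtension f C) l {none} at hJ
  simp only [Finset.filter_empty, Finset.card_empty] at hJ h1
  omega

lemma participantRank_singleton_le (hin : IsProcedureInput part f C) (hl : IsEnumeration l)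
    (x : Option N) : participantRank part (secretExtension f C) l {x} ≤ 1 := by
  have hf := hin.isIntegerPolymatroid_secretExtension
  cases x with
  | none => exact (hin.participantRank_secret hl).le
  | some i =>
    have h := (participantRank_withoutSecret_isLeast part hf hl {i}).2 ⟨∅, rfl⟩
    rw [show withoutSecret {i} = {some i} from Finset.map_singleton _ _] at h
    simpa [hin.polymatroid.rank_empty] using h

lemma participantRank_withSecret_le (hin : IsProcedureInput part f C) (hl : IsEnumeration l)
    (I : Finset N) : participantRank part (secretExtension f C) l (withSecret I) ≤
      participantRank part (secretExtension f C) l (withoutSecret I) + 1 := by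
  have h := (hin.isIntegerPolymatroid_participantRank hl).union_le_add_card
    (hin.participantRank_singleton_le hl) (withoutSecret I) {none}
  rwa [show withoutSecret I ∪ {none} = withSecret I by
    ext (_ | x) <;> simp [withSecret, withoutSecret]] at h

/-- The whole set of participants is qualified: its rank is `f' M`, and `M` belongs to every
nonempty modular cut. -/
lemma univ_mem_qualifiedSets (hin : IsProcedureInput part f C) (hC : C.Nonempty)
    (hl : IsEnumeration l) :
    Finset.univ ∈ qualifiedSets (participantRank part (secretExtension f C) l) := by
  have hf := hin.isIntegerPolymatroid_secretExtension
  have hM : polyClosure f Finset.univ ∈ C := by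
    obtain ⟨F, hF⟩ := hC
    exact hin.modularCut.superset F _ hF (hin.polymatroid.isPolyFlat_polyClosure _)
      ((Finset.subset_univ F).trans (IsIntegerPolymatroid.subset_polyClosure _))
  obtain ⟨J, hJ⟩ := (participantRank_withoutSecret_isLeast part hf hl Finset.univ).1
  have h1 := (participantRank_withSecret_isLeast part hf hl Finset.univ).2 ⟨Finset.univ, rfl⟩
  have h2 := hin.rank_union_le J Jᶜ
  rw [Finset.union_compl] at h2
  refine le_antisymm ((hin.isIntegerPolymatroid_participantRank hl).mono
    (withoutSecret_subset_withSecret _)) ?_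
  simp only [secretExtension_withSecret, if_pos hM, secretExtension_withoutSecret,
    Finset.mem_univ, not_true_eq_false, Finset.filter_false, Finset.card_empty] at h1 hJ
  simp only [Finset.mem_compl] at h2
  omega

theorem isIdealScheme (hin : IsProcedureInput part f C) (hC : C.Nonempty)
    (hl : IsEnumeration l) :
    IsIdealScheme fun J => (participantRank part (secretExtension f C) l J : ℝ) := by
  have hp := hin.isIntegerPolymatroid_participantRank hl
  have h0 := hin.participantRank_secret hl
  have h1 := hin.participantRank_singleton_le hl
  refine ⟨⟨hp, by simp [h0], fun I => ?_⟩, ?_⟩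
  · have h2 := hin.participantRank_withSecret_le hl I
    have h3 := hp.mono (withoutSecret_subset_withSecret I)
    simp only [h0]
    norm_cast
    omega
  · -- some participant has positive rank, because all participants together determine the secret
    obtain ⟨i, hi⟩ : ∃ i : N, participantRank part (secretExtension f C) l {some i} = 1 := by
      by_contra! hne
      have h2 : participantRank part (secretExtension f C) l (∅ ∪ withoutSecret Finset.univ) =
          participantRank part (secretExtension f C) l ∅ :=
        hp.union_eq_of_forall_insert fun e he => by
          obtain ⟨i, -, rfl⟩ := Finset.mem_map.1 he
          have h4 := hne i
          have h5 := h1 (some i)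
          have h6 := hp.rank_empty
          change participantRank part (secretExtension f C) l {some i} = _
          omega
      have h3 : participantRank part (secretExtension f C) l (withoutSecret Finset.univ) =
        participantRank part (secretExtension f C) l (withSecret Finset.univ) :=
        hin.univ_mem_qualifiedSets hC hl
      have h4 := hp.mono (show {none} ⊆ withSecret (Finset.univ : Finset N) by simp [withSecret])
      rw [Finset.empty_union, hp.rank_empty] at h2
      omega
    have hle : ∀ j : N, (participantRank part (secretExtension f C) l {some j} : ℝ) /
        participantRank part (secretExtension f C) l {none} ≤ 1 := fun j => by
      rw [h0, Nat.cast_one, div_one]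
      exact_mod_cast h1 _
    have : Nonempty N := ⟨i⟩
    refine le_antisymm (ciSup_le hle) (le_ciSup_of_le ⟨1, ?_⟩ i ?_)
    · rintro _ ⟨j, rfl⟩
      exact hle j
    · simp [hi, h0]

theorem isAccessStructure (hin : IsProcedureInput part f C) (hC : C.Nonempty)
    (hl : IsEnumeration l) :
    IsAccessStructure (qualifiedSets (participantRank part (secretExtension f C) l)) := by
  have hp := hin.isIntegerPolymatroid_participantRank hl
  refine ⟨⟨_, hin.univ_mem_qualifiedSets hC hl⟩, fun I J hI hIJ => ?_, fun h => ?_⟩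
  · refine le_antisymm (hp.mono (withoutSecret_subset_withSecret J)) ?_
    have h1 : participantRank part (secretExtension f C) l (withoutSecret I) =
      participantRank part (secretExtension f C) l (withSecret I) := hI
    have h2 : participantRank part (secretExtension f C) l (withoutSecret J ∪ {none}) +
        participantRank part (secretExtension f C) l (withoutSecret I) ≤
        participantRank part (secretExtension f C) l (withoutSecret I ∪ {none}) +
        participantRank part (secretExtension f C) l (withoutSecret J) := by
      exact_mod_cast IsPolymatroid.marginal hp (Finset.map_subset_map.2 hIJ) {none}
    have h3 : ∀ I : Finset N, withoutSecret I ∪ {none} = withSecret I := fun I => by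
      ext (_ | x) <;> simp [withSecret, withoutSecret]
    rw [h3, h3] at h2
    omega
  · have h1 : participantRank part (secretExtension f C) l ∅ =
      participantRank part (secretExtension f C) l {none} := h
    rw [hp.rank_empty, hin.participantRank_secret hl] at h1
    omega

theorem isMultipartite (hin : IsProcedureInput part f C) (hl : IsEnumeration l) :
    IsMultipartite part (qualifiedSets (participantRank part (secretExtension f C) l)) := by
  intro I I' h
  have hf := hin.isIntegerPolymatroid_secretExtension
  have h1 := participantRank_withoutSecret_isLeast part hf hl I
  have h2 := participantRank_withSecret_isLeast part hf hl I
  simp only [card_filter_notMem_eq h] at h1 h2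
  simp only [qualifiedSets, Set.mem_ofPred_eq]
  rw [h1.unique (participantRank_withoutSecret_isLeast part hf hl I'),
    h2.unique (participantRank_withSecret_isLeast part hf hl I')]

theorem participantRank_eq (hin : IsProcedureInput part f C) {l₁ l₂ : List N}
    (h₁ : IsEnumeration l₁) (h₂ : IsEnumeration l₂) :
    participantRank part (secretExtension f C) l₁ =
      participantRank part (secretExtension f C) l₂ := by
  have hf := hin.isIntegerPolymatroid_secretExtension
  ext S
  obtain ⟨I, rfl | rfl⟩ := exists_eq_withoutSecret_or_withSecret S
  · exact (participantRank_withoutSecret_isLeast part hf h₁ I).unique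
      (participantRank_withoutSecret_isLeast part hf h₂ I)
  · exact (participantRank_withSecret_isLeast part hf h₁ I).unique
      (participantRank_withSecret_isLeast part hf h₂ I)

end IsProcedureInput

/-! ### Linear representability -/

section LinearRepresentation

open scoped TensorProduct

section BaseChange

variable {F : Type*} [Field F] {V : Type*} [AddCommGroup V] [Module F V]
  (K : Type*) [Field K] [Algebra F K]

lemma baseChange_iSup {ι : Sort*} (U : ι → Submodule F V) :
    (⨆ i, U i).baseChange K = ⨆ i, (U i).baseChange K := by
  refine le_antisymm ?_ (iSup_le fun i => Submodule.baseChange_mono K (le_iSup U i))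
  rw [Submodule.baseChange_eq_span, Submodule.map_iSup, Submodule.span_le]
  change _ ≤ (⨆ i, (U i).baseChange K).restrictScalars F
  refine iSup_le fun i => Submodule.map_le_iff_le_comap.2 fun x hx => ?_
  exact le_iSup (fun i => (U i).baseChange K) i (Submodule.tmul_mem_baseChange_of_mem 1 hx)

lemma finrank_baseChange_submodule (U : Submodule F V) :
    Module.finrank K (U.baseChange K) = Module.finrank F U := by
  have hinj : Function.Injective (U.subtype.baseChange K) :=
    Module.Flat.lTensor_preserves_injective_linearMap _ U.injective_subtype
  have h := LinearMap.finrank_range_of_inj hinj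
  rw [Module.finrank_baseChange] at h
  exact h

/-- A vector with coordinates `w i` with respect to a basis of `K` over `F` lies in the base
change of `U` only if all of its coordinates lie in `U`. -/
lemma mem_of_sum_tmul_mem_baseChange {ι : Type*} [Fintype ι] (b : Module.Basis ι F K)
    (w : ι → V) (U : Submodule F V) (h : ∑ i, b i ⊗ₜ[F] w i ∈ U.baseChange K) (i : ι) :
    w i ∈ U := by
  have h1 : (U.mkQ.baseChange K) (∑ i, b i ⊗ₜ[F] w i) = 0 := by
    have : U.baseChange K ≤ LinearMap.ker (U.mkQ.baseChange K) := by
      rw [Submodule.baseChange_eq_span, Submodule.span_le]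
      rintro _ ⟨x, hx, rfl⟩
      simp [(Submodule.Quotient.mk_eq_zero U).2 hx]
    exact this h
  rw [map_sum] at h1
  simp only [LinearMap.baseChange_tmul] at h1
  have h2 := TensorProduct.sum_tmul_basis_left_eq_zero b
    (Finsupp.equivFunOnFinite.symm fun i => U.mkQ (w i))
    (by rw [Finsupp.sum_fintype _ _ (by simp)]; simpa using h1)
  exact (Submodule.Quotient.mk_eq_zero U).1 (DFunLike.congr_fun h2 i)

end BaseChange

/-- A generic element along `k` is represented over a large extension `K` of the field by the
line through a vector whose coordinates with respect to a basis of `K` over the original field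
span the subspace of `k`: it lies in the base change of a subspace `U` only if `U` contains the
whole subspace of `k`. -/
theorem isLinearlyRepresentable_genericExtension {E : Type*} [DecidableEq E] {f : Finset E → ℕ}
    (h : IsLinearlyRepresentable fun A => (f A : ℝ)) (u k : E) :
    IsLinearlyRepresentable fun A => (genericExtension f u k A : ℝ) := by
  obtain ⟨F, _, _, V, _, _, _, W, hW⟩ := h
  have hW' : ∀ J, f J = Module.finrank F (⨆ i ∈ J, W i : Submodule F V) := fun J => by
    simpa using hW J
  obtain ⟨n, w, hw⟩ := Submodule.fg_iff_exists_fin_generating_family.1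
    (IsNoetherian.noetherian (W k))
  obtain ⟨p, _⟩ := CharP.exists F
  have : Fact p.Prime := ⟨CharP.char_is_prime F p⟩
  -- the additional coordinate `0` keeps the degree of the field extension positive
  let K := FiniteField.Extension F p (n + 1)
  let b : Module.Basis (Fin (n + 1)) F K :=
    Module.finBasisOfFinrankEq F K (FiniteField.finrank_extension F p (n + 1))
  let w' : Fin (n + 1) → V := Fin.cons 0 w
  let v : K ⊗[F] V := ∑ i, b i ⊗ₜ[F] w' i
  have hv : ∀ U : Submodule F V, v ∈ U.baseChange K ↔ W k ≤ U := fun U => by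
    constructor
    · intro hvU
      rw [← hw, Submodule.span_le]
      rintro _ ⟨i, rfl⟩
      exact mem_of_sum_tmul_mem_baseChange K b w' U hvU i.succ
    · intro hU
      refine Submodule.sum_mem _ fun i _ => Submodule.tmul_mem_baseChange_of_mem _ ?_
      induction i using Fin.cases with
      | zero => exact U.zero_mem
      | succ i => exact hU (hw ▸ Submodule.subset_span ⟨i, rfl⟩)
  have hk : ∀ J, f (insert k J) = f J ↔ W k ≤ ⨆ i ∈ J, W i := fun J => by
    rw [hW', hW', Finset.iSup_insert]
    constructor
    · intro he
      rw [Submodule.eq_of_le_of_finrank_eq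
        (le_sup_right : (⨆ i ∈ J, W i) ≤ W k ⊔ ⨆ i ∈ J, W i) he.symm]
      exact le_sup_left
    · intro hle
      rw [sup_eq_right.2 hle]
  refine ⟨K, inferInstance, inferInstance, K ⊗[F] V, inferInstance, inferInstance, inferInstance,
    fun e => if e = u then Submodule.span K {v} else (W e).baseChange K, fun A => ?_⟩
  have herase : ∀ B : Finset E, u ∉ B →
      (⨆ i ∈ B, if i = u then Submodule.span K {v} else (W i).baseChange K) =
        (⨆ i ∈ B, W i).baseChange K := fun B hB => by
    simp only [baseChange_iSup]
    refine iSup_congr fun i => iSup_congr fun hi => ?_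
    rw [if_neg]
    rintro rfl
    exact hB hi
  simp only [genericExtension]
  norm_cast
  by_cases hu : u ∈ A
  · conv_rhs => rw [← Finset.insert_erase hu]
    rw [Finset.iSup_insert, if_pos rfl, herase _ (Finset.notMem_erase u A)]
    by_cases he : f (insert k (A.erase u)) = f (A.erase u)
    · rw [if_neg fun h => h.2 he, sup_eq_right.2, finrank_baseChange_submodule, hW']
      rw [Submodule.span_singleton_le_iff_mem, hv, ← hk, he]
    · rw [if_pos ⟨hu, he⟩, sup_comm, Submodule.finrank_sup_span_singleton,
        finrank_baseChange_submodule, hW']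
      rwa [hv, ← hk]
  · rw [if_neg fun h => hu h.1, Finset.erase_eq_of_notMem hu, herase _ hu,
      finrank_baseChange_submodule, hW']

theorem isLinearlyRepresentable_participantRank {m : ℕ} {N : Type*} [DecidableEq N]
    (part : N → Fin m) {f : Finset (Option (Fin m)) → ℕ}
    (h : IsLinearlyRepresentable fun A => (f A : ℝ)) (l : List N) :
    IsLinearlyRepresentable fun J => (participantRank part f l J : ℝ) := by
  have hadd : IsLinearlyRepresentable fun A => (addGenericElements part f l A : ℝ) := by
    induction l with
    | nil =>
      obtain ⟨F, _, _, V, _, _, _, W, hW⟩ := h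
      refine ⟨F, _, inferInstance, V, _, _, inferInstance, Sum.elim W fun _ => ⊥, fun A => ?_⟩
      simp only [addGenericElements]
      refine (hW _).trans ?_
      suffices he : (⨆ i ∈ A.toLeft, W i) = ⨆ x ∈ A, Sum.elim W (fun _ => ⊥) x by rw [he]
      refine le_antisymm (iSup₂_le fun i hi => ?_) (iSup₂_le fun x hx => ?_)
      · exact le_iSup₂_of_le (Sum.inl i) (Finset.mem_toLeft.1 hi) le_rfl
      · cases x with
        | inl i => exact le_iSup₂_of_le i (Finset.mem_toLeft.2 hx) le_rfl
        | inr i => exact bot_le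
    | cons i l ih => exact isLinearlyRepresentable_genericExtension ih _ _
  obtain ⟨F, _, _, V, _, _, _, W, hW⟩ := hadd
  refine ⟨F, _, inferInstance, V, _, _, inferInstance, fun x => W (secretOrParticipant x),
    fun J => ?_⟩
  simp only [participantRank]
  refine (hW _).trans ?_
  rw [Finset.iSup_finset_image]

end LinearRepresentation

/-! ### Ideal schemes without the secret -/

/-- The trace on the participants of an ideal perfect scheme for `Γ`, normalized so that the
secret has rank `1`. The conditions `jump` and `cross` express, without mentioning the secret,
that the extension by an element of rank `1` which depends exactly on the members of `Γ` is
again a polymatroid. -/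
structure IsPortPolymatroid {N : Type*} [DecidableEq N] (Γ : Set (Finset N))
    (g : Finset N → ℝ) : Prop extends IsPolymatroid g where
  rank_le_one : ∀ i, g {i} ≤ 1
  jump : ∀ A B, A ⊆ B → A ∉ Γ → B ∈ Γ → g A + 1 ≤ g B
  cross : ∀ A B, A ∈ Γ → B ∈ Γ → A ∩ B ∉ Γ → g (A ∪ B) + g (A ∩ B) + 1 ≤ g A + g B

section PortPolymatroid

variable {N : Type*} [DecidableEq N] {Γ : Set (Finset N)} {g : Finset N → ℝ}

theorem isPortPolymatroid_of_isIdealScheme [Finite N] (hΓ : IsAccessStructure Γ)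
    {h : Finset (Option N) → ℝ} (hi : IsIdealScheme h) (hr : Realizes h Γ) :
    IsPortPolymatroid Γ fun I => h (withoutSecret I) / h {none} := by
  have hp := hi.1.polymatroid
  have h0 := hi.1.secret_pos
  have hmem : ∀ I, I ∈ Γ → h (withSecret I) = h (withoutSecret I) := fun I => (hr I).2
  have hnot : ∀ I, I ∉ Γ → h (withSecret I) = h {none} + h (withoutSecret I) := fun I hI =>
    (hi.1.perfect I).resolve_right fun h => hI ((hr I).1 h)
  have hunion : ∀ A B : Finset N, withSecret A ∪ withSecret B = withSecret (A ∪ B) := fun A B => by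
    ext (_ | x) <;> simp [withSecret]
  have hinter : ∀ A B : Finset N, withSecret A ∩ withSecret B = withSecret (A ∩ B) := fun A B => by
    ext (_ | x) <;> simp [withSecret]
  refine ⟨⟨?_, fun A B hAB => ?_, fun A B => ?_⟩, fun i => ?_, fun A B hAB hA hB => ?_,
    fun A B hA hB hAB => ?_⟩
  · simp [withoutSecret, hp.rank_empty]
  · exact div_le_div_of_nonneg_right (hp.mono _ _ (Finset.map_subset_map.2 hAB)) h0.le
  · rw [← add_div, ← add_div]
    refine div_le_div_of_nonneg_right ?_ h0.le
    simpa only [withoutSecret, Finset.map_union, Finset.map_inter] using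
      hp.submodular (withoutSecret A) (withoutSecret B)
  · rw [← hi.2]
    exact le_ciSup (f := fun i : N => h {some i} / h {none}) (Set.finite_range _).bddAbove i
  · rw [div_add_one h0.ne']
    refine div_le_div_of_nonneg_right ?_ h0.le
    rw [← hmem B hB]
    have := hp.mono _ _ (Finset.insertNone.monotone hAB)
    change h (withSecret A) ≤ h (withSecret B) at this
    linarith [hnot A hA]
  · rw [← add_div, ← add_div, div_add_one h0.ne']
    refine div_le_div_of_nonneg_right ?_ h0.le
    have h1 := hp.submodular (withSecret A) (withSecret B)
    rw [hunion, hinter, hmem A hA, hmem B hB, hnot _ hAB,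
      hmem _ (hΓ.superset A _ hA Finset.subset_union_left)] at h1
    linarith

namespace IsPortPolymatroid

lemma insert_le_add_one (hg : IsPortPolymatroid Γ g) (i : N) (A : Finset N) :
    g (insert i A) ≤ g A + 1 := by
  linarith [hg.insert_le i A, hg.rank_le_one i]

lemma average {ι : Type*} {s : Finset ι} (hs : s.Nonempty) {G : ι → Finset N → ℝ}
    (hG : ∀ j ∈ s, IsPortPolymatroid Γ (G j)) :
    IsPortPolymatroid Γ fun A => (∑ j ∈ s, G j A) / s.card := by
  have hc : (0 : ℝ) < s.card := by exact_mod_cast hs.card_pos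
  refine ⟨⟨?_, fun A B hAB => ?_, fun A B => ?_⟩, fun i => ?_, fun A B hAB hA hB => ?_,
    fun A B hA hB hAB => ?_⟩
  · rw [Finset.sum_eq_zero fun j hj => (hG j hj).rank_empty, zero_div]
  · exact div_le_div_of_nonneg_right (Finset.sum_le_sum fun j hj => (hG j hj).mono _ _ hAB) hc.le
  · rw [← add_div, ← add_div, ← Finset.sum_add_distrib, ← Finset.sum_add_distrib]
    exact div_le_div_of_nonneg_right
      (Finset.sum_le_sum fun j hj => (hG j hj).submodular _ _) hc.le
  · rw [div_le_one hc]
    simpa using Finset.sum_le_card_nsmul s _ 1 fun j hj => (hG j hj).rank_le_one i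
  · rw [div_add_one hc.ne']
    refine div_le_div_of_nonneg_right ?_ hc.le
    have h := Finset.sum_le_sum fun j hj => (hG j hj).jump _ _ hAB hA hB
    simpa [Finset.sum_add_distrib] using h
  · rw [← add_div, ← add_div, div_add_one hc.ne']
    refine div_le_div_of_nonneg_right ?_ hc.le
    have h := Finset.sum_le_sum fun j hj => (hG j hj).cross _ _ hA hB hAB
    simpa [Finset.sum_add_distrib] using h

lemma comp_map (hg : IsPortPolymatroid Γ g) (σ : Equiv.Perm N)
    (hσ : ∀ A, A.map σ.toEmbedding ∈ Γ ↔ A ∈ Γ) :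
    IsPortPolymatroid Γ fun A => g (A.map σ.toEmbedding) := by
  refine ⟨⟨by simp [hg.rank_empty], fun A B hAB => hg.mono _ _ (Finset.map_subset_map.2 hAB),
    fun A B => ?_⟩, fun i => by simpa using hg.rank_le_one (σ i),
    fun A B hAB hA hB => hg.jump _ _ (Finset.map_subset_map.2 hAB) (by rwa [hσ]) (by rwa [hσ]),
    fun A B hA hB hAB => ?_⟩
  · rw [Finset.map_union, Finset.map_inter]
    exact hg.submodular _ _
  · rw [Finset.map_union, Finset.map_inter]
    refine hg.cross _ _ (by rwa [hσ]) (by rwa [hσ]) ?_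
    rwa [← Finset.map_inter, hσ]

lemma restrict (hg : IsPortPolymatroid Γ g) (P : N → Prop) [DecidablePred P]
    (hP : ∀ A, A.filter P ∈ Γ ↔ A ∈ Γ) :
    IsPortPolymatroid Γ fun A => g (A.filter P) := by
  refine ⟨⟨by simp [hg.rank_empty], fun A B hAB => hg.mono _ _ (Finset.filter_subset_filter _ hAB),
    fun A B => ?_⟩, fun i => (hg.mono _ _ (Finset.filter_subset _ _)).trans (hg.rank_le_one i),
    fun A B hAB hA hB => hg.jump _ _ (Finset.filter_subset_filter _ hAB) (by rwa [hP])
      (by rwa [hP]), fun A B hA hB hAB => ?_⟩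
  · rw [Finset.filter_union, Finset.filter_inter_distrib]
    exact hg.submodular _ _
  · rw [Finset.filter_union, Finset.filter_inter_distrib]
    refine hg.cross _ _ (by rwa [hP]) (by rwa [hP]) ?_
    rwa [← Finset.filter_inter_distrib, hP]

/-! ### Integrality -/

/-- In the trace of an ideal scheme without useless participants of positive rank, every circuit
`C` has an element which depends on the others. If not, then the increases of the rank at the
elements of `C` over the rest of `C` are strictly between `0` and `1`. Choose `A ∉ Γ` and `y ∈ C`
with `yA ∈ Γ` such that `A \ C` is as small as possible; enlarging `A` by elements of `C`, there
is also `x ∈ C` other than `y` with `xA ∈ Γ`, and `cross` shows that `y` depends on `xA`. By the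
minimality of `A \ C`, this set increases the rank of `C` by its cardinality, so that it can be
removed: `y` depends on `x` and `A ∩ C`. -/
theorem exists_rank_erase_eq [Finite N] (hg : IsPortPolymatroid Γ g) (hΓ : IsAccessStructure Γ)
    (hess : ∀ i, g {i} = 0 ∨ ∃ A, A ∉ Γ ∧ insert i A ∈ Γ) (C : Finset N) (hC : g C < C.card)
    (hsub : ∀ D, D ⊂ C → g D = D.card) : ∃ y ∈ C, g (C.erase y) = g C := by
  classical
  have := Fintype.ofFinite N
  by_contra! hne
  have hmarg : ∀ y ∈ C, ∀ S ⊆ C.erase y, g S < g (insert y S) := fun y hy S hS => by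
    have h1 := hg.marginal_insert hS y
    rw [Finset.insert_erase hy] at h1
    have h2 := lt_of_le_of_ne (hg.mono _ _ (Finset.erase_subset y C)) (hne y hy)
    linarith
  have hlt : ∀ y ∈ C, g C < g (C.erase y) + 1 := fun y hy => by
    have h1 := hsub _ (Finset.erase_ssubset hy)
    have h2 := Finset.card_erase_add_one hy
    rw [h1]
    have h3 : ((C.erase y).card : ℝ) + 1 = C.card := by exact_mod_cast h2
    linarith
  obtain ⟨y₀, hy₀⟩ : C.Nonempty := by
    rw [Finset.nonempty_iff_ne_empty]
    rintro rfl
    simp [hg.rank_empty] at hC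
  obtain ⟨A₀, hA₀⟩ := (hess y₀).resolve_left fun h0 => by
    have h1 := hmarg y₀ hy₀ ∅ (Finset.empty_subset _)
    rw [hg.rank_empty] at h1
    exact h1.ne' h0
  obtain ⟨A₁, hA₁, hmin⟩ := Finset.exists_min_image
    ((Finset.univ : Finset (Finset N)).filter fun A => A ∉ Γ ∧ ∃ y ∈ C, insert y A ∈ Γ)
    (fun A => (A \ C).card) ⟨A₀, by simpa using ⟨hA₀.1, y₀, hy₀, hA₀.2⟩⟩
  simp only [Finset.mem_filter, Finset.mem_univ, true_and] at hA₁ hmin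
  obtain ⟨hA₁Γ, y, hyC, hyA₁⟩ := hA₁
  have hall : A₁ ∪ C.erase y ∈ Γ := by
    by_contra hcon
    have h1 := hg.jump _ _ (Finset.subset_insert y _) hcon
      (hΓ.superset _ _ hyA₁ (Finset.insert_subset_insert y Finset.subset_union_left))
    have h2 := hg.marginal_insert (Finset.subset_union_right : C.erase y ⊆ A₁ ∪ C.erase y) y
    rw [Finset.insert_erase hyC] at h2
    linarith [hlt y hyC]
  obtain ⟨D, hD, hDmax⟩ := Finset.exists_max_image
    ((C.erase y).powerset.filter fun D => A₁ ∪ D ∉ Γ) Finset.card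
    ⟨∅, by simpa using hA₁Γ⟩
  simp only [Finset.mem_filter, Finset.mem_powerset] at hD hDmax
  obtain ⟨x, hxC, hxD⟩ := Finset.exists_of_ssubset
    (hD.1.ssubset_of_ne fun h => hD.2 (h ▸ hall))
  set A := A₁ ∪ D with hA
  have hxA : insert x A ∈ Γ := by
    by_contra hcon
    have := hDmax (insert x D) ⟨Finset.insert_subset hxC hD.1, by
      rwa [Finset.union_insert]⟩
    rw [Finset.card_insert_of_notMem hxD] at this
    omega
  have hyA : insert y A ∈ Γ :=
    hΓ.superset _ _ hyA₁ (Finset.insert_subset_insert y Finset.subset_union_left)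
  have hxy : x ≠ y := Finset.ne_of_mem_erase hxC
  replace hxC := Finset.mem_of_mem_erase hxC
  have hyA' : y ∉ A := fun h => hD.2 (by rwa [Finset.insert_eq_of_mem h] at hyA)
  have hcross : g (insert y (insert x A)) ≤ g (insert x A) := by
    have h1 : insert x A ∩ insert y A = A := by
      ext z; simp only [Finset.mem_inter, Finset.mem_insert]; grind
    have h2 : insert x A ∪ insert y A = insert y (insert x A) := by
      ext z; simp only [Finset.mem_union, Finset.mem_insert]; tauto
    have h3 := hg.cross _ _ hxA hyA (by rw [h1]; exact hD.2)
    rw [h1, h2] at h3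
    linarith [hg.insert_le_add_one y A]
  set U := A₁ \ C with hU
  have hAC : A = (A ∩ C) ∪ U := by
    ext z
    have := @hD.1 z
    simp only [hA, hU, Finset.mem_union, Finset.mem_inter, Finset.mem_sdiff,
      Finset.mem_erase] at this ⊢
    tauto
  have hCU : C ∪ U ∈ Γ := hΓ.superset _ _ hyA fun z hz => by
    rcases Finset.mem_insert.1 hz with rfl | hz
    · exact Finset.mem_union_left _ hyC
    · rw [hAC] at hz
      exact Finset.union_subset_union_left Finset.inter_subset_right hz
  have hnot : ∀ z ∈ U, C ∪ U.erase z ∉ Γ := fun z hz => by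
    have h1 : ∀ D ⊆ C, (A ∩ C) ∪ U.erase z ∪ D ∉ Γ := fun D hDC => by
      induction D using Finset.induction_on with
      | empty =>
        rw [Finset.union_empty]
        refine fun h => hD.2 (hΓ.superset _ _ h ?_)
        conv_rhs => rw [hAC]
        exact Finset.union_subset_union_right (Finset.erase_subset z U)
      | insert c D _ ih =>
        replace ih := ih ((Finset.subset_insert c D).trans hDC)
        intro hmem
        rw [Finset.union_insert] at hmem
        have h2 := hmin _ ⟨ih, c, hDC (Finset.mem_insert_self c D), hmem⟩
        have h3 : ((A ∩ C) ∪ U.erase z ∪ D) \ C ⊆ U.erase z := fun w => by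
          have := @hDC w
          simp only [Finset.mem_sdiff, Finset.mem_union, Finset.mem_inter,
            Finset.mem_insert] at this ⊢
          tauto
        have h4 := Finset.card_le_card h3
        have h5 := Finset.card_erase_lt_of_mem hz
        omega
    refine fun h => h1 C subset_rfl (hΓ.superset _ _ h fun w => ?_)
    simp only [Finset.mem_union]
    tauto
  have hrank : ∀ U' ⊆ U, g C + U'.card ≤ g (C ∪ U') := fun U' => by
    induction U' using Finset.induction_on with
    | empty => simp
    | insert z U' hz ih =>
      intro hsub'
      have hzU := hsub' (Finset.mem_insert_self z U')
      have h1 := ih ((Finset.subset_insert z U').trans hsub')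
      have h2 := hg.jump (C ∪ U.erase z) (C ∪ U)
        (Finset.union_subset_union_right (Finset.erase_subset z U)) (hnot z hzU) hCU
      have h3 : C ∪ U' ⊆ C ∪ U.erase z := Finset.union_subset_union_right fun w hw =>
        Finset.mem_erase.2 ⟨fun h => hz (h ▸ hw), hsub' (Finset.mem_insert_of_mem hw)⟩
      have h4 := hg.marginal_insert h3 z
      rw [← Finset.union_insert, Finset.insert_erase hzU, ← Finset.union_insert] at h4
      rw [Finset.card_insert_of_notMem hz]
      push_cast
      linarith
  have hrank' : ∀ S ⊆ C, g S + U.card ≤ g (S ∪ U) := fun S hS => by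
    linarith [hg.marginal hS U, hrank U subset_rfl]
  have h1 : insert x A = insert x (A ∩ C) ∪ U := by
    rw [Finset.insert_union, ← hAC]
  have h2 := hmarg y hyC (insert x (A ∩ C)) fun z hz => by
    simp only [Finset.mem_insert, Finset.mem_inter, Finset.mem_erase] at hz ⊢
    grind
  have h3 := hg.union_le_add_card hg.rank_le_one (insert x (A ∩ C)) U
  have h4 := hrank' (insert y (insert x (A ∩ C))) fun z hz => by
    simp only [Finset.mem_insert, Finset.mem_inter] at hz
    grind
  rw [h1, ← Finset.insert_union] at hcross
  linarith

theorem exists_nat [Finite N] (hg : IsPortPolymatroid Γ g) (hΓ : IsAccessStructure Γ)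
    (hess : ∀ i, g {i} = 0 ∨ ∃ A, A ∉ Γ ∧ insert i A ∈ Γ) : ∃ r : Finset N → ℕ, ∀ A, g A = r A :=
  Classical.axiomOfChoice fun A =>
    hg.exists_nat_of_circuits hg.rank_le_one (hg.exists_rank_erase_eq hΓ hess) A

end IsPortPolymatroid

end PortPolymatroid

/-! ### Symmetrization -/

lemma IsMultipartite.map_mem_iff {m : ℕ} {N : Type*} {part : N → Fin m} {Γ : Set (Finset N)}
    (hm : IsMultipartite part Γ) {σ : Equiv.Perm N} (hσ : ∀ i, part (σ i) = part i)
    (A : Finset N) : A.map σ.toEmbedding ∈ Γ ↔ A ∈ Γ := by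
  refine hm _ _ fun k => ?_
  rw [Finset.filter_map, Finset.card_map]
  congr 1
  ext i
  simp [hσ]

section Multipartite

variable {m : ℕ} {N : Type*} [DecidableEq N] {part : N → Fin m} {Γ : Set (Finset N)}

lemma IsMultipartite.insert_mem_iff (hm : IsMultipartite part Γ) {i j : N}
    (hij : part i = part j) {X : Finset N} (hi : i ∉ X) (hj : j ∉ X) :
    insert i X ∈ Γ ↔ insert j X ∈ Γ := by
  refine hm _ _ fun k => ?_
  rw [Finset.filter_insert, Finset.filter_insert, hij]
  split_ifs
  · rw [Finset.card_insert_of_notMem (by simp [hi]), Finset.card_insert_of_notMem (by simp [hj])]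
  · rfl

/-- A multipartite `κ`-ideal access structure has a normalized ideal scheme in which useless
participants have rank `0` and which is symmetric in the members of each part: the useless
participants are ignored, and then the rank function is averaged over all permutations of the
participants which preserve the parts. -/
theorem exists_symmetric_isPortPolymatroid [Fintype N] (hΓ : IsAccessStructure Γ)
    (hm : IsMultipartite part Γ) (hκ : IsKappaIdeal Γ) :
    ∃ g : Finset N → ℝ, IsPortPolymatroid Γ g ∧
      (∀ i, g {i} = 0 ∨ ∃ A, A ∉ Γ ∧ insert i A ∈ Γ) ∧
      ∀ i j X, part i = part j → i ∉ X → j ∉ X → g (insert i X) = g (insert j X) := by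
  classical
  obtain ⟨h, hi, hr⟩ := hκ
  have hg₀ := isPortPolymatroid_of_isIdealScheme hΓ hi hr
  set g₀ : Finset N → ℝ := fun I => h (withoutSecret I) / h {none}
  let ess : N → Prop := fun i => ∃ A, A ∉ Γ ∧ insert i A ∈ Γ
  have hremove : ∀ S : Finset N, (∀ i ∈ S, ¬ ess i) → ∀ B, B ∪ S ∈ Γ → B ∈ Γ := by
    intro S hS B hB
    induction S using Finset.induction_on with
    | empty => simpa using hB
    | insert i S _ ih =>
      refine ih (fun j hj => hS j (Finset.mem_insert_of_mem hj)) ?_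
      by_contra hcon
      exact hS i (Finset.mem_insert_self i S) ⟨_, hcon, by rwa [Finset.union_insert] at hB⟩
  have hg₁ := hg₀.restrict ess fun A =>
    ⟨fun hA => hΓ.superset _ _ hA (Finset.filter_subset _ _), fun hA =>
      hremove (A.filter fun i => ¬ ess i) (fun i hi => (Finset.mem_filter.1 hi).2) _
        (by rwa [Finset.filter_union_filter_not_eq])⟩
  set g₁ : Finset N → ℝ := fun A => g₀ (A.filter ess) with hg₁def
  let G : Finset (Equiv.Perm N) := Finset.univ.filter fun σ => ∀ i, part (σ i) = part i
  have hG : ∀ σ, σ ∈ G ↔ ∀ i, part (σ i) = part i := fun σ => by simp [G]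
  refine ⟨_, IsPortPolymatroid.average (s := G)
    (G := fun σ A => g₁ (A.map σ.toEmbedding)) ⟨1, by simp [hG]⟩
    fun σ hσ => hg₁.comp_map σ (hm.map_mem_iff ((hG σ).1 hσ)), fun i => ?_,
    fun i j X hij hiX hjX => ?_⟩
  · by_cases hess : ess i
    · exact Or.inr hess
    left
    rw [Finset.sum_eq_zero, zero_div]
    intro σ hσ
    have hσi : ¬ ess (σ i) := by
      rintro ⟨A, hA, hA'⟩
      have hAσ : (A.map σ.symm.toEmbedding).map σ.toEmbedding = A := by
        ext x; simp
      refine hess ⟨A.map σ.symm.toEmbedding, ?_, ?_⟩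
      · rwa [← hm.map_mem_iff ((hG σ).1 hσ), hAσ]
      · rw [← hm.map_mem_iff ((hG σ).1 hσ), Finset.map_insert, hAσ]
        exact hA'
    have h1 : ({i} : Finset N).map σ.toEmbedding = {σ i} := Finset.map_singleton _ _
    rw [h1, hg₁def]
    simp only [Finset.filter_singleton, if_neg hσi]
    exact hg₀.rank_empty
  · congr 1
    refine Finset.sum_equiv (Equiv.mulRight (Equiv.swap i j)) (fun σ => ?_) fun σ _ => ?_
    · have hswap : ∀ x, part (Equiv.swap i j x) = part x := fun x => by
        rw [Equiv.swap_apply_def]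
        split_ifs with h1 h2
        · rw [h1, hij]
        · rw [h2, hij]
        · rfl
      rw [hG, hG]
      refine ⟨fun h x => ?_, fun h x => ?_⟩
      · simpa [hswap] using h (Equiv.swap i j x)
      · simpa [hswap] using h (Equiv.swap i j x)
    · congr 1
      ext x
      simp only [Finset.mem_map_equiv, Finset.mem_insert, Equiv.coe_mulRight, Equiv.Perm.mul_def,
        Equiv.symm_trans_apply, Equiv.symm_swap]
      generalize σ.symm x = y
      rw [Equiv.swap_apply_def]
      grind

/-! ### Recovering the data of the procedure -/

/-- In a symmetric scheme, let `J` be the set of those parts which are contained in the closure of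
`I`. An element `i ∈ I` of another part can be exchanged for an element of its part outside the
closure of `I`, so that everything that depends on `I` depends already on `I \ {i}`. Therefore
all of these elements can be removed, which leaves the parts in `J`. -/
theorem IsPortPolymatroid.exists_rank_eq [Fintype N] {g : Finset N → ℝ}
    (hg : IsPortPolymatroid Γ g) (hΓ : IsAccessStructure Γ) (hm : IsMultipartite part Γ)
    {r : Finset N → ℕ} (hr : ∀ A, g A = r A)
    (hsymm : ∀ i j X, part i = part j → i ∉ X → j ∉ X → g (insert i X) = g (insert j X))
    (I : Finset N) : ∃ J : Finset (Fin m),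
      g (Finset.univ.filter fun i => part i ∈ J) + (I.filter fun i => part i ∉ J).card = g I ∧
      (I ∈ Γ → (Finset.univ.filter fun i => part i ∈ J) ∈ Γ) := by
  classical
  let J : Finset (Fin m) :=
    Finset.univ.filter fun k => ∀ i, part i = k → g (insert i I) = g I
  have hJ : ∀ k, k ∈ J ↔ ∀ i, part i = k → g (insert i I) = g I := fun k => by simp [J]
  set X₀ := I ∪ (Finset.univ.filter fun i => part i ∈ J) with hX₀
  have hrank : g X₀ = g I := hg.union_eq_of_forall_insert fun e he => by
    rw [Finset.mem_filter, hJ] at he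
    exact he.2 e rfl
  have key : ∀ K ⊆ I.filter (fun i => part i ∉ J),
      g (X₀ \ K) + K.card = g X₀ ∧ (I ∈ Γ → X₀ \ K ∈ Γ) := fun K => by
    induction K using Finset.induction_on with
    | empty =>
      intro _
      simp only [Finset.sdiff_empty, Finset.card_empty, Nat.cast_zero, add_zero, true_and]
      exact fun h => hΓ.superset _ _ h Finset.subset_union_left
    | insert i K hiK ih =>
      intro hK
      obtain ⟨ih1, ih2⟩ := ih ((Finset.subset_insert i K).trans hK)
      obtain ⟨hiI, hiJ⟩ := Finset.mem_filter.1 (hK (Finset.mem_insert_self i K))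
      set X := X₀ \ K with hX
      have hY : X₀ \ insert i K = X.erase i := by
        ext z; simp only [hX, Finset.mem_sdiff, Finset.mem_insert, Finset.mem_erase]; tauto
      set Y := X.erase i with hYdef
      have hiX : i ∈ X := Finset.mem_sdiff.2 ⟨Finset.mem_union_left _ hiI, hiK⟩
      have hYX : insert i Y = X := Finset.insert_erase hiX
      have hiY : i ∉ Y := Finset.notMem_erase i X
      rw [hJ] at hiJ
      push Not at hiJ
      obtain ⟨j, hj, hjI⟩ := hiJ
      have h1 : g I + 1 ≤ g (insert j I) := by
        have h := lt_of_le_of_ne (hg.mono _ _ (Finset.subset_insert j I)) (Ne.symm hjI)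
        rw [hr, hr] at h ⊢
        exact_mod_cast h
      have h2 : g X + 1 ≤ g (insert j X) := by
        have h3 := hg.marginal_insert (Finset.sdiff_subset : X ⊆ X₀) j
        have h4 := hg.mono _ _
          (Finset.insert_subset_insert j (Finset.subset_union_left : I ⊆ X₀))
        linarith
      have hjX : j ∉ X := fun h => by
        rw [Finset.insert_eq_of_mem h] at h2
        linarith
      have hjY : j ∉ Y := fun h => hjX (Finset.mem_of_mem_erase h)
      have h3 : g (insert j Y) = g X := by rw [hsymm j i Y hj hjY hiY, hYX]
      have hinter : X ∩ insert j Y = Y := by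
        ext z; simp only [hYdef, Finset.mem_inter, Finset.mem_insert, Finset.mem_erase]; grind
      have hunion : X ∪ insert j Y = insert j X := by
        ext z; simp only [hYdef, Finset.mem_union, Finset.mem_insert, Finset.mem_erase]; tauto
      have h4 := hg.submodular X (insert j Y)
      rw [hinter, hunion] at h4
      have h5 := hg.insert_le_add_one i Y
      rw [hYX] at h5
      rw [hY, Finset.card_insert_of_notMem hiK]
      push_cast
      refine ⟨by linarith, fun hI => ?_⟩
      by_contra hcon
      have hXΓ := ih2 hI
      have h6 := hg.cross X (insert j Y) hXΓ
        (by rwa [hm.insert_mem_iff hj hjY hiY, hYX]) (by rwa [hinter])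
      rw [hinter, hunion] at h6
      linarith
  have hfinal : X₀ \ I.filter (fun i => part i ∉ J) = Finset.univ.filter fun i => part i ∈ J := by
    ext z; simp only [hX₀, Finset.mem_sdiff, Finset.mem_union, Finset.mem_filter,
      Finset.mem_univ, true_and]; tauto
  obtain ⟨h1, h2⟩ := key _ subset_rfl
  rw [hfinal] at h1 h2
  exact ⟨J, by rw [h1, hrank], h2⟩

/-- The polymatroid on the parts and the modular cut are read off from a symmetric scheme: the
rank of a set of parts is the rank of its union, and a flat belongs to the cut if its union is
qualified. -/
theorem exists_isProcedureInput [Fintype N] (hΓ : IsAccessStructure Γ)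
    (hm : IsMultipartite part Γ) (hκ : IsKappaIdeal Γ) :
    ∃ (f : Finset (Fin m) → ℕ) (C : Set (Finset (Fin m))),
      IsProcedureInput part f C ∧ C.Nonempty ∧ ∀ l, IsEnumeration l →
        Γ = qualifiedSets (participantRank part (secretExtension f C) l) := by
  classical
  obtain ⟨g, hg, hess, hsymm⟩ := exists_symmetric_isPortPolymatroid hΓ hm hκ
  obtain ⟨r, hr⟩ := hg.exists_nat hΓ hess
  let U : Finset (Fin m) → Finset N := fun J => Finset.univ.filter fun i => part i ∈ J
  have hUmono : ∀ {J K}, J ⊆ K → U J ⊆ U K := fun {J K} h i hi => by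
    simp only [U, Finset.mem_filter, Finset.mem_univ, true_and] at hi ⊢
    exact h hi
  have hUunion : ∀ J K, U (J ∪ K) = U J ∪ U K := fun J K => by ext i; simp [U]
  have hUinter : ∀ J K, U (J ∩ K) = U J ∩ U K := fun J K => by ext i; simp [U]
  let f : Finset (Fin m) → ℕ := fun J => r (U J)
  have hfg : ∀ J, (f J : ℝ) = g (U J) := fun J => (hr _).symm
  have hf : IsIntegerPolymatroid f := by
    refine ⟨?_, fun J K h => ?_, fun J K => ?_⟩
    · simpa [hfg, U] using hg.rank_empty
    · rw [hfg, hfg]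
      exact hg.mono _ _ (hUmono h)
    · rw [hfg, hfg, hfg, hfg, hUunion, hUinter]
      exact hg.submodular _ _
  let C : Set (Finset (Fin m)) := {F | IsPolyFlat f F ∧ U F ∈ Γ}
  have hcl : ∀ J, polyClosure f J ∈ C ↔ U J ∈ Γ := fun J => by
    refine ⟨fun h => ?_, fun h => ⟨hf.isPolyFlat_polyClosure J,
      hΓ.superset _ _ h (hUmono (IsIntegerPolymatroid.subset_polyClosure J))⟩⟩
    by_contra hcon
    have h1 := hg.jump _ _ (hUmono (IsIntegerPolymatroid.subset_polyClosure J)) hcon h.2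
    rw [← hfg, ← hfg, hf.rank_polyClosure] at h1
    linarith
  have hempty : U ∅ = ∅ := by simp [U]
  have huniv : U Finset.univ = Finset.univ := by simp [U]
  have hin : IsProcedureInput part f C := by
    refine ⟨hf, fun k => ?_, ⟨fun F hF => hF.1, fun F G hF hG h =>
      ⟨hG, hΓ.superset _ _ hF.2 (hUmono h)⟩, fun F G hF hG hFG => ?_⟩, ?_⟩
    · have h := hg.le_card hg.rank_le_one (U {k})
      rw [← hfg] at h
      simpa [U] using (by exact_mod_cast h : f {k} ≤ (U {k}).card)
    · have hmem : U (F ∩ G) ∈ Γ := by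
        by_contra hcon
        rw [hUinter] at hcon
        have h1 := hg.cross _ _ hF.2 hG.2 hcon
        rw [← hUinter, ← hUunion, ← hfg, ← hfg, ← hfg, ← hfg] at h1
        have h2 : (f F + f G : ℝ) = f (F ∪ G) + f (F ∩ G) := by exact_mod_cast hFG
        linarith
      refine ⟨Finset.Subset.antisymm (fun k hk => ?_)
        (IsIntegerPolymatroid.subset_polyClosure _), hmem⟩
      have h1 := hf.polyClosure_mono (Finset.inter_subset_left : F ∩ G ⊆ F) hk
      have h2 := hf.polyClosure_mono (Finset.inter_subset_right : F ∩ G ⊆ G) hk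
      rw [show polyClosure f F = F from hF.1] at h1
      rw [show polyClosure f G = G from hG.1] at h2
      exact Finset.mem_inter.2 ⟨h1, h2⟩
    · have h := secretExtension_withSecret f C ∅
      rw [hcl, hempty, if_neg hΓ.empty_notMem, hf.rank_empty] at h
      exact h
  have hNΓ : (Finset.univ : Finset N) ∈ Γ := by
    obtain ⟨A, hA⟩ := hΓ.nonempty
    exact hΓ.superset _ _ hA (Finset.subset_univ A)
  refine ⟨f, C, hin, ⟨_, (hcl Finset.univ).2 (huniv ▸ hNΓ)⟩, fun l hl => ?_⟩
  have hp := hin.isIntegerPolymatroid_participantRank hl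
  ext I
  have h0 := participantRank_withSecret_isLeast part hin.isIntegerPolymatroid_secretExtension hl I
  simp only [secretExtension_withSecret, hcl] at h0
  have hle : ∀ J, g (I ∪ U J) ≤ f J + (I.filter fun i => part i ∉ J).card := fun J => by
    rw [hfg]
    refine (hg.mono _ _ fun i hi => ?_).trans (hg.union_le_add_card hg.rank_le_one _ _)
    simp only [U, Finset.mem_union, Finset.mem_filter, Finset.mem_univ, true_and] at hi ⊢
    tauto
  obtain ⟨J₀, hJ₀, hJ₀Γ⟩ := hg.exists_rank_eq hΓ hm hr hsymm I
  have hr' : participantRank part (secretExtension f C) l (withoutSecret I) = r I := by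
    refine (participantRank_withoutSecret_isLeast part
      hin.isIntegerPolymatroid_secretExtension hl I).unique ⟨⟨J₀, ?_⟩, ?_⟩
    · simp only [secretExtension_withoutSecret]
      rw [hr, hr] at hJ₀
      exact_mod_cast hJ₀
    · rintro _ ⟨J, rfl⟩
      simp only [secretExtension_withoutSecret]
      have h := (hg.mono _ _ (Finset.subset_union_left : I ⊆ I ∪ U J)).trans (hle J)
      rw [hr] at h
      exact_mod_cast h
  have hmono := hp.mono (withoutSecret_subset_withSecret I)
  change I ∈ Γ ↔ participantRank part (secretExtension f C) l (withoutSecret I) =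
    participantRank part (secretExtension f C) l (withSecret I)
  rw [hr'] at hmono ⊢
  constructor
  · intro hI
    have h1 := h0.2 ⟨J₀, rfl⟩
    simp only [if_pos (show U J₀ ∈ Γ from hJ₀Γ hI)] at h1
    rw [hr, hr] at hJ₀
    have h2 : f J₀ + (I.filter fun i => part i ∉ J₀).card = r I := by exact_mod_cast hJ₀
    omega
  · intro heq
    obtain ⟨J, hJ⟩ := h0.1
    simp only [← heq] at hJ
    have h1 := hle J
    have h2 := hg.mono _ _ (Finset.subset_union_left : I ⊆ I ∪ U J)
    have h3 : ((if U J ∈ Γ then f J else f J + 1 : ℕ) : ℝ) +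
        (I.filter fun i => part i ∉ J).card = g I := by
      rw [hr]
      exact_mod_cast hJ
    split_ifs at h3 with hUJ
    · by_contra hI
      have h4 := hg.jump I (I ∪ U J) Finset.subset_union_left hI
        (hΓ.superset _ _ hUJ Finset.subset_union_right)
      linarith
    · push_cast at h3
      linarith

end Multipartite

/-! ### The characterization -/

theorem theorem2p4 {m : ℕ} {N : Type*} [Fintype N] [DecidableEq N] (part : N → Fin m) :
    -- the procedure generates exactly the `κ`-ideal multipartite access structures
    (∀ Γ : Set (Finset N),
      (IsAccessStructure Γ ∧ IsMultipartite part Γ ∧ IsKappaIdeal Γ) ↔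
        ∃ (f' : Finset (Fin m) → ℕ) (C : Set (Finset (Fin m))) (l : List N),
          IsProcedureInput part f' C ∧ C.Nonempty ∧ IsEnumeration l ∧
          Γ = qualifiedSets (participantRank part (secretExtension f' C) l)) ∧
    -- properties of every run of the procedure
    (∀ (f' : Finset (Fin m) → ℕ) (C : Set (Finset (Fin m))), IsProcedureInput part f' C →
      IsIntegerPolymatroid (secretExtension f' C) ∧
      -- the result does not depend on the order of the extensions
      (∀ l₁ l₂ : List N, IsEnumeration l₁ → IsEnumeration l₂ →
        participantRank part (secretExtension f' C) l₁ =
          participantRank part (secretExtension f' C) l₂) ∧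
      (∀ l : List N, IsEnumeration l →
        -- the result is a matroid
        IsMatroidRank (participantRank part (secretExtension f' C) l) ∧
        -- it is an ideal scheme
        (C.Nonempty →
          IsIdealScheme fun J => (participantRank part (secretExtension f' C) l J : ℝ)) ∧
        -- linear representability is preserved
        ((IsLinearlyRepresentable fun A => (secretExtension f' C A : ℝ)) →
          (IsLinearlyRepresentable fun J =>
            (participantRank part (secretExtension f' C) l J : ℝ)) ∧
          (C.Nonempty → HasIdealLinearScheme
            (qualifiedSets (participantRank part (secretExtension f' C) l)))))) := by
  refine ⟨fun Γ => ⟨?_, ?_⟩, fun f' C hin => ⟨hin.isIntegerPolymatroid_secretExtension,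
    fun l₁ l₂ => hin.participantRank_eq, fun l hl => ⟨?_, fun hC => hin.isIdealScheme hC hl,
      fun hlin => ?_⟩⟩⟩
  · rintro ⟨hΓ, hm, hκ⟩
    obtain ⟨f, C, hin, hC, hq⟩ := exists_isProcedureInput hΓ hm hκ
    have hl : IsEnumeration (Finset.univ : Finset N).toList :=
      ⟨Finset.nodup_toList _, fun i => by simp⟩
    exact ⟨f, C, _, hin, hC, hl, hq _ hl⟩
  · rintro ⟨f, C, l, hin, hC, hl, rfl⟩
    exact ⟨hin.isAccessStructure hC hl, hin.isMultipartite hl, _, hin.isIdealScheme hC hl,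
      realizes_qualifiedSets _⟩
  · exact (hin.isIntegerPolymatroid_participantRank hl).isMatroidRank
      (hin.participantRank_singleton_le hl)
  · have hlin' := isLinearlyRepresentable_participantRank part hlin l
    exact ⟨hlin', fun hC => ⟨_, hin.isIdealScheme hC hl,
      realizes_qualifiedSets _, hlin'⟩⟩
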